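/- Let $\rho:\mathbb R^3\to\mathbb R$ be compactly supported and spherically symmetric, with $\rho,\nabla\rho,\nabla\nabla\rho\in L^2(\mathbb R^3)$ (weak derivatives). Put $\hat\rho(k)=(2\pi)^{-3/2}\int_{\mathbb R^3} e^{ik\cdot x}\rho(x)\,dx$, and assume that $\hat\rho(k)\neq0$ for all $k\neq 0$ (Wiener condition) and that $\partial^\alpha\hat\rho(0)=0$ for all multi-indices with $|\alpha|\le4$. Let $v=(|v|,0,0)$ with $|v|<1$, $\nu=\sqrt{1-|v|^2}$, and $B_v=\nu(I_3-v\otimes v)=\mathrm{diag}(\nu^3,\nu,\nu)$. For $\mathrm{Re}\,\lambda>0$ set $$K_{ij}=\int_{\mathbb R^3}\frac{k_ik_j|\hat\rho(k)|^2}{k^2-(|v|k_1)^2}\,dk,\qquad H_{ij}(\lambda)=\int_{\mathbb R^3}\frac{k_ik_j|\hat\rho(k)|^2}{k^2+(i|v|k_1+\lambda)^2}\,dk,\qquad F(\lambda)=H(\lambda)-K,$$ $$M(\lambda)=\begin{pmatrix}\lambda I_3&-B_v\\-F(\lambda)&\lambda I_3\end{pmatrix}.$$ For every $\omega\in\mathbb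 R$ the limit $M(i\omega):=\lim_{\varepsilon\to0+}M(i\omega+\varepsilon)$ exists. For every $r>0$ there are diagonal $3\times3$ matrix functions $\mathcal L_{11},\mathcal L_{12},\mathcal L_{21},\mathcal L_{22}\in C^\infty(-r-1,r+1)$ with complex entries such that, for all $\omega\in(-r-1,r+1)$ with $\omega\ne0$, the matrix $M(i\omega)$ is invertible and $$M^{-1}(i\omega)=\begin{pmatrix}\frac1\omega\mathcal L_{11}(\omega)&\frac1{\omega^2}\mathcal L_{12}(\omega)\\[2pt]\mathcal L_{21}(\omega)&\frac1\omega\mathcal L_{22}(\omega)\end{pmatrix},$$ and $\mathcal L_{11}(\omega)=i\,\mathcal L_{12}(\omega)B_v^{-1}$ for all $\omega\in(-r-1,r+1)$. -/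

import Mathlib

open MeasureTheory Filter Topology Set
open scoped ContDiff

noncomputable section

namespace WaveParticle

/-- Physical (and Fourier) space `ℝ³` with its Euclidean norm; coordinates `0, 1, 2`. -/
abbrev E3 := EuclideanSpace ℝ (Fin 3)

/-- `g` is the weak partial derivative `∂ᵢ f` on `ℝ³` (tested against `C_c^∞`). -/
def IsWeakPartial (i : Fin 3) (f g : E3 → ℝ) : Prop :=
  ∀ φ : E3 → ℝ, ContDiff ℝ ∞ φ → HasCompactSupport φ →
    ∫ x, f x * fderiv ℝ φ x (EuclideanSpace.single i 1) = - ∫ x, g x * φ x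

/-- The standing conditions on the charge distribution: `ρ, ∇ρ, ∇∇ρ ∈ L²(ℝ³)`,
`ρ` has compact support, and `ρ` is spherically symmetric. -/
structure IsChargeDistribution (ρ : E3 → ℝ) : Prop where
  memLp : MemLp ρ 2 volume
  memLp_deriv : ∃ (g : Fin 3 → E3 → ℝ) (h : Fin 3 → Fin 3 → E3 → ℝ),
    (∀ i, MemLp (g i) 2 volume ∧ IsWeakPartial i ρ (g i)) ∧
    (∀ i j, MemLp (h i j) 2 volume ∧ IsWeakPartial j (g i) (h i j))
  compact : ∃ R : ℝ, ∀ x, R ≤ ‖x‖ → ρ x = 0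
  radial : ∃ ρ₁ : ℝ → ℝ, ∀ x, ρ x = ρ₁ ‖x‖

/-- `ρ̂(k) = (2π)^{-3/2} ∫ e^{ik·x} ρ(x) dx`. -/
def rhoHat (ρ : E3 → ℝ) (k : E3) : ℂ :=
  (((2 * Real.pi) ^ (-(3 / 2 : ℝ)) : ℝ) : ℂ) *
    ∫ x, Complex.exp (Complex.I * (inner ℝ k x : ℝ)) * (ρ x : ℂ)

/-- The Wiener condition: `ρ̂(k) ≠ 0` for all `k ≠ 0`. -/
def WienerCondition (ρ : E3 → ℝ) : Prop :=
  ∀ k : E3, k ≠ 0 → rhoHat ρ k ≠ 0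

/-- All partial derivatives of `ρ̂` of order at most `4` vanish at `k = 0`. -/
def FifthOrderZero (ρ : E3 → ℝ) : Prop :=
  ∀ n : ℕ, n ≤ 4 → iteratedFDeriv ℝ n (rhoHat ρ) 0 = 0

/-- `ν = √(1 - v²)`. -/
def nu (v : E3) : ℝ := Real.sqrt (1 - ‖v‖ ^ 2)

/-- `B_v = ν (I₃ - v ⊗ v)`. -/
def B (v : E3) : Matrix (Fin 3) (Fin 3) ℂ :=
  Matrix.of fun i j => ((nu v * ((if i = j then 1 else 0) - v i * v j) : ℝ) : ℂ)

/-- `D̂(λ, k) = k² + (i v·k + λ)²`. -/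
def Dhat (v : E3) (lam : ℂ) (k : E3) : ℂ :=
  ((‖k‖ ^ 2 : ℝ) : ℂ) + (Complex.I * (inner ℝ v k : ℝ) + lam) ^ 2

/-- `K_{ij} = ∫ kᵢ kⱼ |ρ̂(k)|² / (k² - (v·k)²) dk`. -/
def K (ρ : E3 → ℝ) (v : E3) : Matrix (Fin 3) (Fin 3) ℂ :=
  Matrix.of fun i j =>
    ((∫ k : E3, k i * k j * ‖rhoHat ρ k‖ ^ 2 / (‖k‖ ^ 2 - (inner ℝ v k) ^ 2) : ℝ) : ℂ)

/-- `H_{ij}(λ) = ∫ kᵢ kⱼ |ρ̂(k)|² / (k² + (i v·k + λ)²) dk`, used for `Re λ > 0`. -/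
def H (ρ : E3 → ℝ) (v : E3) (lam : ℂ) : Matrix (Fin 3) (Fin 3) ℂ :=
  Matrix.of fun i j =>
    ∫ k : E3, ((k i * k j * ‖rhoHat ρ k‖ ^ 2 : ℝ) : ℂ) / Dhat v lam k

/-- `F(λ) = H(λ) - K`. -/
def F (ρ : E3 → ℝ) (v : E3) (lam : ℂ) : Matrix (Fin 3) (Fin 3) ℂ := H ρ v lam - K ρ v

/-- The `6 × 6` matrix `M(λ) = (λ I₃, -B_v; -F(λ), λ I₃)`, used for `Re λ > 0`. -/
def M (ρ : E3 → ℝ) (v : E3) (lam : ℂ) : Matrix (Fin 3 ⊕ Fin 3) (Fin 3 ⊕ Fin 3) ℂ :=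
  Matrix.fromBlocks (lam • 1) (-B v) (-F ρ v lam) (lam • 1)

/-- The boundary value `M(i om) := M(i om + 0) = lim_{ε → 0+} M(i om + ε)`. -/
def MBoundary (ρ : E3 → ℝ) (v : E3) (om : ℝ) : Matrix (Fin 3 ⊕ Fin 3) (Fin 3 ⊕ Fin 3) ℂ :=
  limUnder (𝓝[>] (0 : ℝ)) fun ε : ℝ => M ρ v (Complex.I * om + ε)

end WaveParticle

end

open scoped FourierTransform RealInnerProductSpace

noncomputable section

namespace WaveParticle

/-! Everything rests on one fact: each diagonal entry `H_jj` extends to an entire function of `λ`.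
Write `D̂(λ, k) = (λ - i(|k| - v·k)) (λ + i(|k| + v·k))` and split `1/D̂` into partial fractions.
Using `k ↦ -k` in the second fraction and polar coordinates `k = rθ`, evenness of the radial profile
of `|ρ̂|²` merges the two half-line integrals into `∫_ℝ r³|ρ̂|²(r) / (λ - irq) dr` with `q = 1 - v·θ
> 0`. This is the Laplace transform of `t ↦ κ(qt)`, where `κ` is the Fourier transform of
`r³|ρ̂|²(r)` (`waveKernel`). The profile is, up to a constant, the Fourier transform of the
autocorrelation of a one-dimensional marginal of `ρ`, so `κ` has compact support: a form of Huygens'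
principle. A Laplace integral over a bounded time interval, averaged over the sphere, is entire
(`H_eq_HExt`, `differentiable_HExt`), so the boundary limit exists.

Reflections fixing the direction of `v` make `F` diagonal, so `M` splits into 2×2 blocks with
determinant `λ² - b_j f_j(λ)`, where `f_j` is the extension of `F_jj` and `b_j > 0` is the diagonal
entry of `B_v`. For small real `ε > 0` a direct estimate gives `-Cε² ≤ f_j(ε) ≤ 0`, hence `f_j = λ²
G_j` with `G_j` entire and `Re G_j(0) ≤ 0` (`F_apply_ofReal_bounds`, `exists_eq_sq_mul`).

The determinant is therefore `λ² (1 - b_j G_j)`, and the second factor has no zero on the imaginary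
axis. At `0` its real part is at least `1`. At `iω ≠ 0`, Fourier inversion expresses `Im f_j(iω)` as
a nonzero multiple of `ω³` times a spherical average of `|ρ̂|²`, which is positive by the Wiener
condition (`im_HExt_ne_zero`). Inverting the 2×2 blocks gives the stated powers of `1/ω` with smooth
coefficients. -/

/-! ### Fourier transforms of compactly supported `L²` functions. -/

/-- The Fourier integral of a function in `L¹ ∩ L²` is square integrable. -/
theorem memLp_two_fourier {E : Type*} [NormedAddCommGroup E] [InnerProductSpace ℝ E]
    [FiniteDimensional ℝ E] [MeasurableSpace E] [BorelSpace E] {f : E → ℂ}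
    (hf : Integrable f) (hf2 : MemLp f 2) : MemLp (𝓕 f) 2 := by
  set f' : Lp ℂ 2 (volume : Measure E) := hf2.toLp f with hf'
  have hcont : Continuous (𝓕 f) := VectorFourier.fourierIntegral_continuous
    Real.continuous_fourierChar (by exact continuous_inner) hf
  -- The Fourier integral and the Plancherel transform agree as distributions: both move onto the
  -- test function by `∫ 𝓕f · g = ∫ f · 𝓕g`.
  have key : ∀ᵐ x, 𝓕 f x = (𝓕 f' : Lp ℂ 2 (volume : Measure E)) x := by
    refine ae_eq_of_integral_contDiff_smul_eq hcont.locallyIntegrable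
      ((Lp.memLp _).locallyIntegrable (by norm_num)) fun g hg hgc => ?_
    have hg₁ : HasCompactSupport (Complex.ofRealCLM ∘ g) := hgc.comp_left rfl
    have hg₂ : ContDiff ℝ ∞ (Complex.ofRealCLM ∘ g) := by fun_prop
    let gS : SchwartzMap E ℂ := hg₁.toSchwartzMap hg₂
    have h1 := congrArg (fun T : TemperedDistribution E ℂ => T gS)
      (Lp.fourier_toTemperedDistribution_eq f')
    simp only [TemperedDistribution.fourier_apply, Lp.toTemperedDistribution_apply] at h1
    have h2 := VectorFourier.integral_fourierIntegral_smul_eq_flip (L := innerₗ E)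
      Real.continuous_fourierChar (by exact continuous_inner) hf (gS.integrable (μ := volume))
    have h3 : ∫ x, (𝓕 gS) x • f' x = ∫ x, f x • (𝓕 gS) x := by
      refine integral_congr_ae ?_
      filter_upwards [hf2.coeFn_toLp] with x hx
      rw [hf', hx, smul_eq_mul, smul_eq_mul, mul_comm]
    calc ∫ x, g x • 𝓕 f x = ∫ x, 𝓕 f x • gS x := by
          refine integral_congr_ae (Eventually.of_forall fun x => ?_)
          simp [gS, mul_comm]
      _ = ∫ x, f x • (𝓕 gS) x := by
          rw [SchwartzMap.fourier_coe]
          rw [flip_innerₗ] at h2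
          exact h2
      _ = ∫ x, g x • (𝓕 f' : Lp ℂ 2 (volume : Measure E)) x := by
          rw [← h3, h1]
          refine integral_congr_ae (Eventually.of_forall fun x => ?_)
          simp [gS]
  exact (Lp.memLp (𝓕 f' : Lp ℂ 2 (volume : Measure E))).ae_eq (key.mono fun x hx => hx.symm)

theorem rhoHat_eq_fourier (g : E3 → ℝ) (k : E3) :
    rhoHat g k = (((2 * Real.pi) ^ (-(3 / 2 : ℝ)) : ℝ) : ℂ) *
      𝓕 (fun x => (g x : ℂ)) (-(2 * Real.pi)⁻¹ • k) := by
  rw [rhoHat, Real.fourier_eq']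
  congr 1
  refine integral_congr_ae (Eventually.of_forall fun x => ?_)
  simp only [smul_eq_mul]
  congr 2
  rw [inner_smul_right, real_inner_comm]
  push_cast
  have : (Real.pi : ℂ) ≠ 0 := by exact_mod_cast Real.pi_ne_zero
  field_simp

theorem continuous_rhoHat {g : E3 → ℝ} (hg : Integrable g) : Continuous (rhoHat g) := by
  have hcont : Continuous (𝓕 fun x => (g x : ℂ)) := VectorFourier.fourierIntegral_continuous
    Real.continuous_fourierChar (by exact continuous_inner) hg.ofReal
  rw [funext (rhoHat_eq_fourier g)]
  fun_prop

theorem integrable_norm_sq_rhoHat {g : E3 → ℝ} (hg : Integrable g) (hg2 : MemLp g 2) :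
    Integrable fun k => ‖rhoHat g k‖ ^ 2 := by
  have h := (memLp_two_fourier hg.ofReal hg2.ofReal).integrable_norm_pow (by norm_num)
  have hpi : -(2 * Real.pi)⁻¹ ≠ 0 := by have := Real.pi_pos; simp [Real.pi_ne_zero]
  have h' := (h.comp_smul hpi).const_mul (‖(((2 * Real.pi) ^ (-(3 / 2 : ℝ)) : ℝ) : ℂ)‖ ^ 2)
  refine h'.congr (Eventually.of_forall fun k => ?_)
  simp only [rhoHat_eq_fourier, norm_mul, mul_pow]
  rfl

theorem rhoHat_comp_isometry {g : E3 → ℝ} (hg : ∃ g₁ : ℝ → ℝ, ∀ x, g x = g₁ ‖x‖)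
    (S : E3 ≃ₗᵢ[ℝ] E3) (k : E3) : rhoHat g (S k) = rhoHat g k := by
  obtain ⟨g₁, hg₁⟩ := hg
  rw [rhoHat, rhoHat, ← (S.measurePreserving).integral_comp S.toHomeomorph.measurableEmbedding]
  simp [hg₁]

/-- Two vectors of equal norm are exchanged by the reflection in the hyperplane orthogonal to their
difference. -/
theorem rhoHat_eq_of_norm_eq {g : E3 → ℝ} (hg : ∃ g₁ : ℝ → ℝ, ∀ x, g x = g₁ ‖x‖)
    {k l : E3} (h : ‖k‖ = ‖l‖) : rhoHat g k = rhoHat g l := by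
  rw [← Submodule.reflection_sub h, rhoHat_comp_isometry hg]

/-- A square integrable function vanishing almost everywhere outside a ball is integrable. -/
theorem integrable_of_memLp_two_of_ae_eq_zero {g : E3 → ℝ} (hg : MemLp g 2) {R : ℝ}
    (hR : ∀ᵐ x, R < ‖x‖ → g x = 0) : Integrable g := by
  have : IsFiniteMeasure (volume.restrict (Metric.closedBall (0 : E3) R)) :=
    ⟨by simpa using measure_closedBall_lt_top (μ := volume) (x := (0 : E3)) (r := R)⟩
  have h1 : IntegrableOn g (Metric.closedBall 0 R) :=
    (hg.restrict _).integrable (by norm_num)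
  have h2 : IntegrableOn g (Metric.closedBall 0 R)ᶜ := by
    refine (integrable_zero _ _ _).congr ?_
    filter_upwards [ae_restrict_mem Metric.isClosed_closedBall.measurableSet.compl,
      ae_restrict_of_ae hR] with x hx hx'
    exact (hx' (by simpa using hx)).symm
  simpa using h1.union h2

/-- Since the value at `0` vanishes, `e^{ik·x}` may be replaced by `e^{ik·x} - 1`, which is at most
`|k| |R|` in modulus wherever `g` is nonzero. -/
theorem norm_rhoHat_le {g : E3 → ℝ} (hg : Integrable g) {R : ℝ}
    (hR : ∀ x, R ≤ ‖x‖ → g x = 0) (h0 : rhoHat g 0 = 0) :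
    ∃ C, 0 ≤ C ∧ ∀ k, ‖rhoHat g k‖ ≤ C * ‖k‖ := by
  refine ⟨‖(((2 * Real.pi) ^ (-(3 / 2 : ℝ)) : ℝ) : ℂ)‖ * ∫ x, |R| * |g x|, by positivity,
    fun k => ?_⟩
  have e1 : rhoHat g k = rhoHat g k - rhoHat g 0 := by rw [h0, sub_zero]
  have hi : ∀ k : E3, Integrable fun x : E3 =>
      Complex.exp (Complex.I * (inner ℝ k x : ℝ)) * (g x : ℂ) := fun k => by
    refine (hg.ofReal (𝕜 := ℂ)).bdd_mul (c := 1) (by fun_prop) (Eventually.of_forall fun x => ?_)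
    rw [mul_comm, Complex.norm_exp_ofReal_mul_I]
  rw [e1, rhoHat, rhoHat, ← mul_sub, ← integral_sub (hi k) (hi 0), norm_mul, mul_assoc]
  gcongr
  rw [← integral_mul_const]
  refine norm_integral_le_of_norm_le ((hg.abs.const_mul _).mul_const _)
    (Eventually.of_forall fun x => ?_)
  rw [← sub_mul, norm_mul, Complex.norm_real, Real.norm_eq_abs]
  by_cases hx : R ≤ ‖x‖
  · simp [hR x hx]
  have h1 : ‖Complex.exp (Complex.I * (inner ℝ k x : ℝ)) -
      Complex.exp (Complex.I * (inner ℝ (0 : E3) x : ℝ))‖ ≤ ‖k‖ * |R| := by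
    simp only [inner_zero_left, Complex.ofReal_zero, mul_zero, Complex.exp_zero]
    refine (Real.norm_exp_I_mul_ofReal_sub_one_le).trans ?_
    refine (norm_inner_le_norm k x).trans ?_
    gcongr
    exact (not_le.mp hx).le.trans (le_abs_self R)
  nlinarith [abs_nonneg (g x)]

theorem IsWeakPartial.ae_eq_zero {i : Fin 3} {f g : E3 → ℝ} (h : IsWeakPartial i f g)
    (hg : MemLp g 2) {R : ℝ} (hR : ∀ x, R ≤ ‖x‖ → f x = 0) : ∀ᵐ x, R < ‖x‖ → g x = 0 := by
  have hU : IsOpen {x : E3 | R < ‖x‖} := isOpen_lt continuous_const continuous_norm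
  refine hU.ae_eq_zero_of_integral_contDiff_smul_eq_zero
    ((hg.locallyIntegrable (by norm_num)).locallyIntegrableOn _) fun φ hφ hφc hφU => ?_
  have h1 := h φ hφ hφc
  have h2 : ∀ x, f x * fderiv ℝ φ x (EuclideanSpace.single i 1) = 0 := fun x => by
    by_cases hx : R ≤ ‖x‖
    · simp [hR x hx]
    · have : fderiv ℝ φ x = 0 := by
        by_contra hne
        have := hφU (support_fderiv_subset ℝ (f := φ) hne)
        exact hx (le_of_lt this)
      simp [this]
  simp only [h2, integral_zero] at h1
  simp only [smul_eq_mul, mul_comm (φ _)]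
  linarith

/-- Weak derivatives of compactly supported functions may be tested with arbitrary smooth
functions. -/
theorem IsWeakPartial.integral_mul_fderiv {i : Fin 3} {f g : E3 → ℝ} (h : IsWeakPartial i f g)
    {R : ℝ} (hR : ∀ x, R ≤ ‖x‖ → f x = 0) (hgR : ∀ᵐ x, R < ‖x‖ → g x = 0)
    {u : E3 → ℝ} (hu : ContDiff ℝ ∞ u) :
    ∫ x, f x * fderiv ℝ u x (EuclideanSpace.single i 1) = - ∫ x, g x * u x := by
  -- A cutoff equal to `1` on a ball strictly larger than the support, so that neither `u` nor its
  -- derivative changes there.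
  let η : ContDiffBump (0 : E3) := ⟨|R| + 1, |R| + 2, by positivity, by linarith⟩
  have h1 := h (fun x => η x * u x) (η.contDiff.mul hu) (η.hasCompactSupport.mul_right)
  have h2 : ∀ x, f x * fderiv ℝ (fun x => η x * u x) x (EuclideanSpace.single i 1) =
      f x * fderiv ℝ u x (EuclideanSpace.single i 1) := fun x => by
    by_cases hx : R ≤ ‖x‖
    · simp [hR x hx]
    · have hx' : x ∈ Metric.ball (0 : E3) (|R| + 1) := by
        rw [mem_ball_zero_iff]
        linarith [le_abs_self R]
      have : (fun x => η x * u x) =ᶠ[𝓝 x] u := by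
        filter_upwards [Metric.isOpen_ball.mem_nhds hx'] with y hy
        rw [η.one_of_mem_closedBall (Metric.ball_subset_closedBall hy), one_mul]
      rw [this.fderiv_eq]
  have h3 : ∫ x, g x * (η x * u x) = ∫ x, g x * u x := by
    refine integral_congr_ae ?_
    filter_upwards [hgR] with x hx
    by_cases hxR : R < ‖x‖
    · simp [hx hxR]
    · have hx' : x ∈ Metric.closedBall (0 : E3) (|R| + 1) := by
        rw [mem_closedBall_zero_iff]
        linarith [le_abs_self R]
      rw [η.one_of_mem_closedBall hx', one_mul]
  simp only [h2, h3] at h1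
  exact h1

/-- Integration by parts against `e^{ik·x}`, carried out on the cosine and sine separately because
the test functions are real. -/
theorem IsWeakPartial.mul_rhoHat {i : Fin 3} {f g : E3 → ℝ} (h : IsWeakPartial i f g)
    (hf : Integrable f) (hg : Integrable g)
    {R : ℝ} (hR : ∀ x, R ≤ ‖x‖ → f x = 0) (hgR : ∀ᵐ x, R < ‖x‖ → g x = 0) (k : E3) :
    (k i : ℂ) * rhoHat f k = Complex.I * rhoHat g k := by
  have hL : ∀ x, HasFDerivAt (fun x : E3 => inner ℝ k x) (innerSL ℝ k) x := fun x =>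
    (innerSL ℝ k).hasFDerivAt
  have hki : innerSL ℝ k (EuclideanSpace.single i (1 : ℝ)) = k i := by
    simp [EuclideanSpace.inner_single_right]
  have hcos := h.integral_mul_fderiv hR hgR (u := fun x => Real.cos (inner ℝ k x))
    (Real.contDiff_cos.comp (contDiff_const.inner ℝ contDiff_id))
  have hsin := h.integral_mul_fderiv hR hgR (u := fun x => Real.sin (inner ℝ k x))
    (Real.contDiff_sin.comp (contDiff_const.inner ℝ contDiff_id))
  simp only [((hL _).cos).fderiv, ((hL _).sin).fderiv, smul_apply, hki,
    smul_eq_mul] at hcos hsin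
  have hexp : ∀ {w : E3 → ℝ}, Integrable w →
      ∫ x, Complex.exp (Complex.I * (inner ℝ k x : ℝ)) * (w x : ℂ) =
        ((∫ x, w x * Real.cos (inner ℝ k x) : ℝ) : ℂ) +
          Complex.I * ((∫ x, w x * Real.sin (inner ℝ k x) : ℝ) : ℂ) := by
    intro w hw
    have hc : Integrable fun x => w x * Real.cos (inner ℝ k x) :=
      hw.mul_bdd (c := 1) (by fun_prop) (Eventually.of_forall fun x => Real.abs_cos_le_one _)
    have hs : Integrable fun x => w x * Real.sin (inner ℝ k x) :=
      hw.mul_bdd (c := 1) (by fun_prop) (Eventually.of_forall fun x => Real.abs_sin_le_one _)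
    rw [← integral_complex_ofReal, ← integral_complex_ofReal, ← integral_const_mul,
      ← integral_add hc.ofReal (hs.ofReal.const_mul _)]
    refine integral_congr_ae (Eventually.of_forall fun x => ?_)
    simp only
    rw [mul_comm Complex.I, Complex.exp_mul_I]
    push_cast
    ring
  have e1 : (∫ x, g x * Real.cos (inner ℝ k x)) = k i * ∫ x, f x * Real.sin (inner ℝ k x) := by
    rw [← integral_const_mul, ← neg_eq_iff_eq_neg.mpr hcos, ← integral_neg]
    refine integral_congr_ae (Eventually.of_forall fun x => ?_)
    simp only
    ring
  have e2 : (∫ x, g x * Real.sin (inner ℝ k x)) = -(k i * ∫ x, f x * Real.cos (inner ℝ k x)) := by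
    rw [← integral_const_mul, ← neg_eq_iff_eq_neg.mpr hsin]
    congr 1
    refine integral_congr_ae (Eventually.of_forall fun x => ?_)
    simp only
    ring
  rw [rhoHat, rhoHat, hexp hf, hexp hg, e1, e2]
  push_cast
  linear_combination (((2 * Real.pi) ^ (-(3 / 2 : ℝ)) : ℝ) : ℂ) * (k i : ℂ) *
    ((∫ x, f x * Real.cos (inner ℝ k x) : ℝ) : ℂ) * Complex.I_sq

theorem IsChargeDistribution.integrable {ρ : E3 → ℝ} (hρ : IsChargeDistribution ρ) :
    Integrable ρ := by
  obtain ⟨R, hR⟩ := hρ.compact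
  exact integrable_of_memLp_two_of_ae_eq_zero hρ.memLp
    (Eventually.of_forall fun x hx => hR x hx.le)

/-- By Plancherel applied to the first weak derivatives, `∑ᵢ |kᵢ ρ̂|²` is a sum of integrable
functions. This decay is what makes `r³|ρ̂|²` integrable on the line. -/
theorem IsChargeDistribution.integrable_norm_sq_mul {ρ : E3 → ℝ} (hρ : IsChargeDistribution ρ) :
    Integrable fun k : E3 => ‖k‖ ^ 2 * ‖rhoHat ρ k‖ ^ 2 := by
  obtain ⟨R, hR⟩ := hρ.compact
  obtain ⟨g, -, hg, -⟩ := hρ.memLp_deriv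
  have hgR := fun i => (hg i).2.ae_eq_zero (hg i).1 hR
  have hgi := fun i => integrable_of_memLp_two_of_ae_eq_zero (hg i).1 (hgR i)
  have h1 : Integrable fun k : E3 => ∑ i, ‖rhoHat (g i) k‖ ^ 2 :=
    integrable_finsetSum _ fun i _ => integrable_norm_sq_rhoHat (hgi i) (hg i).1
  refine h1.congr (Eventually.of_forall fun k => ?_)
  simp only
  rw [EuclideanSpace.norm_sq_eq, Finset.sum_mul]
  refine Finset.sum_congr rfl fun i _ => ?_
  have h2 := congrArg (‖·‖) ((hg i).2.mul_rhoHat hρ.integrable (hgi i) hR (hgR i) k)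
  simp only [norm_mul, Complex.norm_I, one_mul, Complex.norm_real] at h2
  rw [← h2, mul_pow]

/-! ### The radial profile and the support of its Fourier transform. -/

/-- The radial profile of `|ρ̂|²`, extended to an even function on the whole line. -/
def profile (ρ : E3 → ℝ) (r : ℝ) : ℝ := ‖rhoHat ρ (EuclideanSpace.single 0 r)‖ ^ 2

theorem profile_nonneg (ρ : E3 → ℝ) (r : ℝ) : 0 ≤ profile ρ r := sq_nonneg _

theorem profile_pos {ρ : E3 → ℝ} (hW : WienerCondition ρ) {r : ℝ} (hr : r ≠ 0) :
    0 < profile ρ r := by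
  have : (EuclideanSpace.single 0 r : E3) ≠ 0 := by simpa using hr
  exact pow_pos (norm_pos_iff.mpr (hW _ this)) 2

section Profile

variable {ρ : E3 → ℝ} (hρ : IsChargeDistribution ρ)
include hρ

theorem IsChargeDistribution.profile_norm (k : E3) : profile ρ ‖k‖ = ‖rhoHat ρ k‖ ^ 2 := by
  rw [profile, rhoHat_eq_of_norm_eq hρ.radial (l := k) (by simp)]

theorem IsChargeDistribution.profile_neg (r : ℝ) : profile ρ (-r) = profile ρ r := by
  rw [profile, profile, rhoHat_eq_of_norm_eq hρ.radial (l := EuclideanSpace.single 0 r) (by simp)]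

theorem IsChargeDistribution.continuous_profile : Continuous (profile ρ) := by
  have h1 := continuous_rhoHat hρ.integrable
  have h2 : Continuous fun r : ℝ => (EuclideanSpace.single 0 r : E3) :=
    (ContinuousLinearMap.toSpanSingleton ℝ (EuclideanSpace.single 0 1 : E3)).continuous.congr
      fun r => by ext i; by_cases h : i = 0 <;> simp [h]
  unfold profile
  fun_prop

/-- Polar coordinates turn `|k|²|ρ̂|² ∈ L¹(ℝ³)` into integrability of `r⁴` times the profile on `(0,
∞)`. Lower powers are dominated for `r ≥ 1`, continuity covers `[0, 1]`, and evenness covers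
negative `r`. -/
theorem IsChargeDistribution.integrable_pow_mul_profile {n : ℕ} (hn : n ≤ 3) :
    Integrable fun r : ℝ => r ^ n * profile ρ r := by
  have hc := hρ.continuous_profile
  have h2 : IntegrableOn (fun r : ℝ => r ^ 4 * profile ρ r) (Ioi 0) := by
    have h := (integrable_fun_norm_addHaar (volume : Measure E3)
      (f := fun r => r ^ 2 * profile ρ r)).mp (by
        simpa only [hρ.profile_norm] using hρ.integrable_norm_sq_mul)
    refine h.congr (Eventually.of_forall fun r => ?_)
    simp only [finrank_euclideanSpace, Fintype.card_fin, smul_eq_mul]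
    ring
  have h3 : IntegrableOn (fun r : ℝ => r ^ n * profile ρ r) (Ioi 0) := by
    rw [← Ioc_union_Ioi_eq_Ioi (zero_le_one (α := ℝ))]
    refine IntegrableOn.union ?_ ?_
    · exact (Continuous.integrableOn_Icc (by fun_prop)).mono_set Ioc_subset_Icc_self
    · refine Integrable.mono' (h2.mono_set (Ioi_subset_Ioi zero_le_one))
        (by fun_prop) ?_
      filter_upwards [ae_restrict_mem measurableSet_Ioi] with r hr
      have hr' : (1 : ℝ) ≤ r := le_of_lt hr
      have hr0 : (0 : ℝ) ≤ r := by linarith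
      rw [Real.norm_of_nonneg (mul_nonneg (pow_nonneg hr0 _) (profile_nonneg _ _))]
      exact mul_le_mul_of_nonneg_right (pow_le_pow_right₀ hr' (by omega)) (profile_nonneg _ _)
  have h4 : IntegrableOn (fun r : ℝ => r ^ n * profile ρ r) (Iio 0) := by
    have h5 : IntegrableOn (fun r : ℝ => (-r) ^ n * profile ρ (-r)) (Iio 0) := by
      simpa using IntegrableOn.comp_neg_Iio (c := 0) (f := fun r : ℝ => r ^ n * profile ρ r)
        (by simpa using h3)
    refine (h5.const_mul ((-1) ^ n)).congr (Eventually.of_forall fun r => ?_)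
    simp only [hρ.profile_neg]
    rw [neg_pow r, ← mul_assoc, ← mul_assoc, ← pow_add, ← two_mul, pow_mul]
    simp
  have h6 := h4.union h3
  rw [← integrableOn_univ]
  refine h6.congr_set_ae ?_
  rw [Iio_union_Ioi]
  exact (eventuallyEq_univ.mpr (compl_mem_ae_iff.mpr (by simp))).symm

/-- The Fourier transform of the profile has compact support. -/
theorem IsChargeDistribution.exists_fourier_profile_eq_zero :
    ∃ T : ℝ, 0 < T ∧ ∀ t, T < |t| → 𝓕 (fun r => (profile ρ r : ℂ)) t = 0 := by
  obtain ⟨R, hR⟩ := hρ.compact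
  -- Coordinate differences of points of the support are at most `2|R|`; rescaling by `1/(2π)` only
  -- shrinks them, and `+ 1` keeps `T` positive.
  set T : ℝ := 2 * |R| + 1 with hT
  have hint : Integrable fun r => (profile ρ r : ℂ) := by
    simpa using (hρ.integrable_pow_mul_profile (n := 0) (by norm_num)).ofReal (𝕜 := ℂ)
  have hcont : Continuous (𝓕 fun r => (profile ρ r : ℂ)) :=
    VectorFourier.fourierIntegral_continuous Real.continuous_fourierChar
      (by exact continuous_inner) hint
  have hU : IsOpen {t : ℝ | T < |t|} := isOpen_lt continuous_const continuous_abs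
  refine ⟨T, by positivity, ?_⟩
  suffices h : ∀ᵐ t : ℝ, t ∈ {t : ℝ | T < |t|} → 𝓕 (fun r => (profile ρ r : ℂ)) t = 0 from
    Measure.eqOn_open_of_ae_eq (g := fun _ => (0 : ℂ)) ((ae_restrict_iff' hU.measurableSet).mpr h)
      hU hcont.continuousOn continuousOn_const
  refine hU.ae_eq_zero_of_integral_contDiff_smul_eq_zero
    (hcont.locallyIntegrable.locallyIntegrableOn _) fun χ hχ hχc hχU => ?_
  have hg₁ : HasCompactSupport (Complex.ofRealCLM ∘ χ) := hχc.comp_left rfl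
  have hg₂ : ContDiff ℝ ∞ (Complex.ofRealCLM ∘ χ) := by fun_prop
  let S : SchwartzMap ℝ ℂ := hg₁.toSchwartzMap hg₂
  have hflip := VectorFourier.integral_fourierIntegral_smul_eq_flip (L := innerₗ ℝ)
    Real.continuous_fourierChar (by exact continuous_inner) hint (S.integrable (μ := volume))
  rw [flip_innerₗ] at hflip
  set c : ℂ := (((2 * Real.pi) ^ (-(3 / 2 : ℝ)) : ℝ) : ℂ) with hc
  -- `|ρ̂|² = ρ̂ · conj ρ̂` as a double integral: frequency `r` is paired only with the difference
  -- of the first coordinates.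
  have hprof : ∀ r : ℝ, (profile ρ r : ℂ) = c ^ 2 * ∫ p : E3 × E3,
      Complex.exp (Complex.I * (r * (p.1 0 - p.2 0) : ℝ)) * ((ρ p.1 : ℂ) * (ρ p.2 : ℂ)) := by
    intro r
    have e1 : (profile ρ r : ℂ) = rhoHat ρ (EuclideanSpace.single 0 r) *
        (starRingEnd ℂ) (rhoHat ρ (EuclideanSpace.single 0 r)) := by
      rw [Complex.mul_conj, Complex.normSq_eq_norm_sq, profile]
    rw [e1, rhoHat, ← hc, map_mul, ← integral_conj, hc, Complex.conj_ofReal, ← hc]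
    rw [mul_mul_mul_comm, ← sq]
    congr 1
    rw [Measure.volume_eq_prod, ← integral_prod_mul]
    refine integral_congr_ae (Eventually.of_forall fun p => ?_)
    simp only [map_mul, Complex.conj_ofReal, ← Complex.exp_conj, Complex.conj_I,
      EuclideanSpace.inner_single_left]
    rw [mul_mul_mul_comm, ← Complex.exp_add]
    congr 2
    simp
    ring
  -- By Fubini and inversion this pairing is a double integral of `ρ(x) ρ(y) χ((x₀ - y₀)/2π)`, and
  -- `χ` vanishes at all differences that occur.
  have hswap : ∫ r : ℝ, (profile ρ r : ℂ) • (𝓕 S) r = 0 := by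
    have e2 : ∀ r : ℝ, (profile ρ r : ℂ) • (𝓕 S) r = c ^ 2 * ∫ p : E3 × E3,
        Complex.exp (Complex.I * (r * (p.1 0 - p.2 0) : ℝ)) * ((ρ p.1 : ℂ) * (ρ p.2 : ℂ))
          * (𝓕 S) r := fun r => by
      rw [hprof r, smul_eq_mul, mul_assoc, integral_mul_const]
    simp only [e2]
    rw [integral_const_mul, integral_integral_swap]
    · have e3 : ∀ p : E3 × E3, ∫ r : ℝ, Complex.exp (Complex.I * (r * (p.1 0 - p.2 0) : ℝ)) *
          ((ρ p.1 : ℂ) * (ρ p.2 : ℂ)) * (𝓕 S) r = 0 := by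
        intro p
        have e4 : (∫ r : ℝ, Complex.exp (Complex.I * (r * (p.1 0 - p.2 0) : ℝ)) * (𝓕 S) r) =
            S ((2 * Real.pi)⁻¹ * (p.1 0 - p.2 0)) := by
          have e5 := congrArg (fun f : SchwartzMap ℝ ℂ => f ((2 * Real.pi)⁻¹ * (p.1 0 - p.2 0)))
            (FourierTransform.fourierInv_fourier_eq (F := SchwartzMap ℝ ℂ) S)
          simp only at e5
          rw [← e5, SchwartzMap.fourierInv_coe, Real.fourierInv_eq']
          refine integral_congr_ae (Eventually.of_forall fun r => ?_)
          simp only [smul_eq_mul]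
          congr 2
          have : (Real.pi : ℂ) ≠ 0 := by exact_mod_cast Real.pi_ne_zero
          simp
          field_simp
        have e6 : ∀ r : ℝ, Complex.exp (Complex.I * (r * (p.1 0 - p.2 0) : ℝ)) *
            ((ρ p.1 : ℂ) * (ρ p.2 : ℂ)) * (𝓕 S) r = ((ρ p.1 : ℂ) * (ρ p.2 : ℂ)) *
            (Complex.exp (Complex.I * (r * (p.1 0 - p.2 0) : ℝ)) * (𝓕 S) r) := fun r => by ring
        simp only [e6]
        rw [integral_const_mul, e4]
        by_cases h1 : R ≤ ‖p.1‖
        · simp [hR _ h1]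
        by_cases h2 : R ≤ ‖p.2‖
        · simp [hR _ h2]
        have h3 : |(2 * Real.pi)⁻¹ * (p.1 0 - p.2 0)| ≤ T := by
          have a1 := PiLp.norm_apply_le p.1 0
          have a2 := PiLp.norm_apply_le p.2 0
          have a3 := abs_sub (p.1 0) (p.2 0)
          rw [Real.norm_eq_abs] at a1 a2
          have a4 : (2 * Real.pi)⁻¹ ≤ 1 := inv_le_one_of_one_le₀ (by linarith [Real.pi_gt_three])
          rw [abs_mul, abs_of_pos (by positivity)]
          have := le_abs_self R
          nlinarith [abs_nonneg (p.1 0 - p.2 0)]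
        have h4 : χ ((2 * Real.pi)⁻¹ * (p.1 0 - p.2 0)) = 0 := by
          by_contra hne
          exact absurd (hχU (subset_tsupport _ hne)) (not_lt.mpr h3)
        have h5 : S ((2 * Real.pi)⁻¹ * (p.1 0 - p.2 0)) = 0 := by
          rw [← Complex.ofReal_zero, ← h4]
          rfl
        rw [h5, mul_zero]
      rw [integral_congr_ae (Eventually.of_forall e3), integral_zero, mul_zero]
    · have i1 : Integrable fun z : ℝ × (E3 × E3) =>
          (𝓕 S) z.1 * ((ρ z.2.1 : ℂ) * (ρ z.2.2 : ℂ)) :=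
        ((𝓕 S).integrable (μ := volume)).mul_prod
          ((hρ.integrable.ofReal (𝕜 := ℂ)).mul_prod (hρ.integrable.ofReal (𝕜 := ℂ)))
      have i2 := i1.bdd_mul (c := 1) (f := fun z : ℝ × (E3 × E3) =>
        Complex.exp (Complex.I * (z.1 * (z.2.1 0 - z.2.2 0) : ℝ))) (by fun_prop)
        (Eventually.of_forall fun z => by
          rw [mul_comm Complex.I, Complex.norm_exp_ofReal_mul_I])
      refine i2.congr (Eventually.of_forall fun z => ?_)
      simp only [Function.uncurry]
      ring
  calc ∫ t, χ t • 𝓕 (fun r => (profile ρ r : ℂ)) t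
      = ∫ t, 𝓕 (fun r => (profile ρ r : ℂ)) t • S t := by
        refine integral_congr_ae (Eventually.of_forall fun x => ?_)
        simp [S, mul_comm]
    _ = ∫ r : ℝ, (profile ρ r : ℂ) • (𝓕 S) r := by
        rw [SchwartzMap.fourier_coe]
        exact hflip
    _ = 0 := hswap

end Profile

/-! ### The wave kernel: compact support and Fourier inversion. -/

/-- The Fourier transform of `r³ |ρ̂|²(r)`, in the normalization `∫ e^{itr} r³ |ρ̂|²(r) dr`. -/
def waveKernel (ρ : E3 → ℝ) (t : ℝ) : ℂ :=
  ∫ r : ℝ, Complex.exp (Complex.I * (t * r : ℝ)) * ((r ^ 3 * profile ρ r : ℝ) : ℂ)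

theorem waveKernel_eq_fourier (ρ : E3 → ℝ) (t : ℝ) :
    waveKernel ρ t = 𝓕 (fun r => ((r ^ 3 * profile ρ r : ℝ) : ℂ)) (-(2 * Real.pi)⁻¹ * t) := by
  rw [Real.fourier_eq', waveKernel]
  refine integral_congr_ae (Eventually.of_forall fun r => ?_)
  simp only [smul_eq_mul]
  congr 2
  have : (Real.pi : ℂ) ≠ 0 := by exact_mod_cast Real.pi_ne_zero
  simp
  field_simp

theorem conj_waveKernel (ρ : E3 → ℝ) (t : ℝ) :
    (starRingEnd ℂ) (waveKernel ρ t) = waveKernel ρ (-t) := by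
  rw [waveKernel, ← integral_conj, waveKernel]
  refine integral_congr_ae (Eventually.of_forall fun r => ?_)
  simp only [map_mul, Complex.conj_ofReal, ← Complex.exp_conj, Complex.conj_I]
  congr 2
  simp

section WaveKernel

variable {ρ : E3 → ℝ} (hρ : IsChargeDistribution ρ)
include hρ

theorem IsChargeDistribution.continuous_waveKernel : Continuous (waveKernel ρ) := by
  have hcont : Continuous (𝓕 fun r => ((r ^ 3 * profile ρ r : ℝ) : ℂ)) :=
    VectorFourier.fourierIntegral_continuous Real.continuous_fourierChar
      (by exact continuous_inner) (hρ.integrable_pow_mul_profile le_rfl).ofReal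
  rw [funext (waveKernel_eq_fourier ρ)]
  fun_prop

/-- Up to a constant and a rescaling, the kernel is the third derivative of the Fourier transform of
the profile, and differentiation does not enlarge the support. -/
theorem IsChargeDistribution.exists_waveKernel_eq_zero :
    ∃ T : ℝ, 0 < T ∧ ∀ t, T < |t| → waveKernel ρ t = 0 := by
  obtain ⟨T, hT, h⟩ := hρ.exists_fourier_profile_eq_zero
  refine ⟨2 * Real.pi * T, by positivity, fun t ht => ?_⟩
  have ht' : T < |-(2 * Real.pi)⁻¹ * t| := by
    rw [abs_mul, abs_neg, abs_of_pos (by positivity), inv_mul_eq_div, lt_div_iff₀ (by positivity)]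
    linarith
  have h1 := Real.iteratedDeriv_fourier (f := fun r => (profile ρ r : ℂ)) (N := 3) (n := 3)
    (fun n hn => by
      have hn' : n ≤ 3 := by exact_mod_cast hn
      refine ((hρ.integrable_pow_mul_profile hn').ofReal (𝕜 := ℂ)).congr
        (Eventually.of_forall fun r => ?_)
      simp) le_rfl
  have hU : IsOpen {t : ℝ | T < |t|} := isOpen_lt continuous_const continuous_abs
  have h2 : 𝓕 (fun r => (profile ρ r : ℂ)) =ᶠ[𝓝 (-(2 * Real.pi)⁻¹ * t)] fun _ => 0 := by
    filter_upwards [hU.mem_nhds ht'] with s hs using h s hs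
  have h3 := h2.iteratedDeriv_eq 3
  rw [h1] at h3
  have h4 : (fun r : ℝ => (-2 * Real.pi * Complex.I * r : ℂ) ^ 3 • (profile ρ r : ℂ)) =
      (-2 * Real.pi * Complex.I : ℂ) ^ 3 • fun r => ((r ^ 3 * profile ρ r : ℝ) : ℂ) := by
    ext r
    simp
    ring
  have h5 : 𝓕 ((-2 * Real.pi * Complex.I : ℂ) ^ 3 • fun r => ((r ^ 3 * profile ρ r : ℝ) : ℂ)) =
      (-2 * Real.pi * Complex.I : ℂ) ^ 3 • 𝓕 fun r => ((r ^ 3 * profile ρ r : ℝ) : ℂ) :=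
    VectorFourier.fourierIntegral_const_smul _ _ _ _ _
  have h6 : (-2 * Real.pi * Complex.I : ℂ) ^ 3 ≠ 0 := by
    simp [Real.pi_ne_zero]
  rw [h4, h5, Pi.smul_apply, smul_eq_mul, iteratedDeriv_const] at h3
  rw [waveKernel_eq_fourier]
  exact (mul_eq_zero.mp (by simpa using h3)).resolve_left h6

theorem IsChargeDistribution.integrable_waveKernel : Integrable (waveKernel ρ) := by
  obtain ⟨T, hT, h⟩ := hρ.exists_waveKernel_eq_zero
  refine hρ.continuous_waveKernel.integrable_of_hasCompactSupport
    (HasCompactSupport.intro (isCompact_Icc (a := -T) (b := T)) fun t ht => h t ?_)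
  by_contra hle
  exact ht (abs_le.mp (not_lt.mp hle))

theorem IsChargeDistribution.integral_exp_mul_waveKernel (η : ℝ) :
    ∫ t : ℝ, Complex.exp (-(Complex.I * (η * t : ℝ))) * waveKernel ρ t =
      2 * Real.pi * ((η ^ 3 * profile ρ η : ℝ) : ℂ) := by
  set φ : ℝ → ℂ := fun r => ((r ^ 3 * profile ρ r : ℝ) : ℂ) with hφ
  have hpi : -(2 * Real.pi)⁻¹ ≠ 0 := by simp [Real.pi_ne_zero]
  have hcont : Continuous φ := by
    have := hρ.continuous_profile
    fun_prop
  have hint : Integrable (𝓕 φ) := by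
    rw [← integrable_comp_mul_left_iff _ hpi]
    exact hρ.integrable_waveKernel.congr
      (Eventually.of_forall fun t => waveKernel_eq_fourier ρ t)
  have hinv := congrFun (hcont.fourierInv_fourier_eq
    (hρ.integrable_pow_mul_profile le_rfl).ofReal hint) η
  rw [Real.fourierInv_eq'] at hinv
  have h1 := Measure.integral_comp_mul_left (fun w : ℝ =>
    Complex.exp ((2 * Real.pi * inner ℝ w η : ℝ) * Complex.I) • 𝓕 φ w) (-(2 * Real.pi)⁻¹)
  rw [hinv] at h1
  have h2 : |(-(2 * Real.pi)⁻¹)⁻¹| = 2 * Real.pi := by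
    rw [inv_neg, inv_inv, abs_neg, abs_of_pos (by positivity)]
  rw [h2] at h1
  calc _ = _ := by
        refine (integral_congr_ae (Eventually.of_forall fun t => ?_)).trans h1
        simp only [smul_eq_mul, waveKernel_eq_fourier]
        congr 2
        have : (Real.pi : ℂ) ≠ 0 := by exact_mod_cast Real.pi_ne_zero
        simp
        field_simp
    _ = _ := by simp [hφ]

end WaveKernel

/-! ### Polar coordinates and Laplace transforms. -/

/-- Integration in polar coordinates on `ℝ³`. -/
theorem integral_eq_integral_sphere {f : E3 → ℂ} (hf : Integrable f) :
    ∫ k, f k = ∫ θ : Metric.sphere (0 : E3) 1,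
      (∫ r in Ioi (0 : ℝ), (r ^ 2 : ℝ) • f (r • (θ : E3))) ∂(volume : Measure E3).toSphere := by
  have hmp := (volume : Measure E3).measurePreserving_homeomorphUnitSphereProd
  have hemb := (Homeomorph.measurableEmbedding (homeomorphUnitSphereProd E3))
  have hset : MeasurableSet ({0}ᶜ : Set E3) := (measurableSet_singleton _).compl
  have hval : ∀ x : ({0}ᶜ : Set E3), f x = (fun p : Metric.sphere (0 : E3) 1 × Ioi (0 : ℝ) =>
      f ((p.2 : ℝ) • (p.1 : E3))) (homeomorphUnitSphereProd E3 x) := fun x => by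
    have hx : ‖(x : E3)‖ ≠ 0 := norm_ne_zero_iff.mpr x.2
    simp [smul_smul, hx]
  have hint : Integrable (fun p : Metric.sphere (0 : E3) 1 × Ioi (0 : ℝ) =>
      f ((p.2 : ℝ) • (p.1 : E3)))
      ((volume : Measure E3).toSphere.prod (.volumeIoiPow (Module.finrank ℝ E3 - 1))) := by
    rw [← hmp.integrable_comp_emb hemb]
    have h1 : IntegrableOn f ({0}ᶜ : Set E3) := hf.integrableOn
    rw [integrableOn_iff_comap_subtypeVal hset] at h1
    exact h1.congr (Eventually.of_forall hval)
  calc ∫ k, f k = ∫ x : ({0}ᶜ : Set E3), f x ∂((volume : Measure E3).comap (↑)) := by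
        rw [integral_subtype_comap hset f, restrict_compl_singleton]
    _ = ∫ p, f ((p.2 : ℝ) • (p.1 : E3))
        ∂((volume : Measure E3).toSphere.prod (.volumeIoiPow (Module.finrank ℝ E3 - 1))) := by
        rw [← hmp.integral_comp hemb]
        exact integral_congr_ae (Eventually.of_forall hval)
    _ = _ := by
        rw [integral_prod _ hint]
        refine integral_congr_ae (Eventually.of_forall fun θ => ?_)
        simp only [Measure.volumeIoiPow, ENNReal.ofReal, finrank_euclideanSpace, Fintype.card_fin]
        rw [integral_withDensity_eq_integral_smul
          (measurable_subtype_coe.pow_const _).real_toNNReal,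
          integral_subtype_comap measurableSet_Ioi
            fun a : ℝ => Real.toNNReal (a ^ (3 - 1)) • f (a • (θ : E3))]
        refine setIntegral_congr_fun measurableSet_Ioi fun x hx => ?_
        simp only [NNReal.smul_def, Nat.add_one_sub_one, Real.coe_toNNReal _ (sq_nonneg x)]

theorem integral_eq_integral_Ioi_add_integral_neg_Ioi {f : ℝ → ℂ} (hf : Integrable f) :
    ∫ t, f t = (∫ t in Ioi (0 : ℝ), f (-t)) + ∫ t in Ioi (0 : ℝ), f t := by
  rw [← setIntegral_univ, ← Iic_union_Ioi (a := (0 : ℝ)),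
    setIntegral_union (Set.Iic_disjoint_Ioi le_rfl) measurableSet_Ioi hf.integrableOn
      hf.integrableOn, integral_comp_neg_Ioi, neg_zero]

/-- Laplace–Fourier integrals over bounded exponents are entire. -/
theorem differentiable_integral_mul_exp {X : Type*} [MeasurableSpace X] {μ : Measure X}
    {c : X → ℂ} {b : X → ℝ} {T : ℝ} (hc : Integrable c μ) (hb : Measurable b)
    (hT : ∀ᵐ x ∂μ, |b x| ≤ T) :
    Differentiable ℂ fun z : ℂ => ∫ x, c x * Complex.exp (-(z * b x)) ∂μ := by
  intro z
  have hexp : ∀ᵐ x ∂μ, ∀ w : ℂ, ‖Complex.exp (-(w * b x))‖ ≤ Real.exp (‖w‖ * T) := by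
    filter_upwards [hT] with x hx w
    rw [Complex.norm_exp]
    gcongr
    refine (Complex.re_le_norm _).trans ?_
    rw [norm_neg, norm_mul, Complex.norm_real, Real.norm_eq_abs]
    gcongr
  refine (hasDerivAt_integral_of_dominated_loc_of_deriv_le (μ := μ) (𝕜 := ℂ)
    (F := fun z x => c x * Complex.exp (-(z * b x)))
    (F' := fun z x => c x * (Complex.exp (-(z * b x)) * -(b x : ℂ)))
    (bound := fun x => ‖c x‖ * (Real.exp ((‖z‖ + 1) * T) * T))
    (Metric.ball_mem_nhds z one_pos) ?_ ?_ ?_ ?_ ?_ ?_).2.differentiableAt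
  · exact Eventually.of_forall fun w => hc.aestronglyMeasurable.mul
      (by fun_prop : Measurable _).aestronglyMeasurable
  · exact hc.mul_bdd (c := Real.exp (‖z‖ * T)) (by fun_prop : Measurable _).aestronglyMeasurable
      (hexp.mono fun x hx => hx z)
  · exact hc.aestronglyMeasurable.mul (by fun_prop : Measurable _).aestronglyMeasurable
  · filter_upwards [hexp, hT] with x hx hxT w hw
    have hw' : ‖w‖ ≤ ‖z‖ + 1 := by
      have h1 := norm_le_norm_add_norm_sub' w z
      have h2 := mem_ball_iff_norm.mp hw
      linarith
    have hT0 : 0 ≤ T := (abs_nonneg _).trans hxT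
    rw [norm_mul, norm_mul, norm_neg, Complex.norm_real, Real.norm_eq_abs]
    have := hx w
    have h3 : Real.exp (‖w‖ * T) ≤ Real.exp ((‖z‖ + 1) * T) := by gcongr
    gcongr
    linarith
  · exact hc.norm.mul_const _
  · refine Eventually.of_forall fun x w _ => ?_
    have h1 : HasDerivAt (fun w : ℂ => -(w * (b x : ℂ))) (-(b x : ℂ)) w := by
      simpa using! ((hasDerivAt_id w).mul_const (b x : ℂ)).neg
    exact h1.cexp.const_mul (c x)

section Laplace

variable {ρ : E3 → ℝ} (hρ : IsChargeDistribution ρ)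
include hρ

theorem IsChargeDistribution.norm_waveKernel_le (t : ℝ) :
    ‖waveKernel ρ t‖ ≤ ∫ r : ℝ, ‖((r ^ 3 * profile ρ r : ℝ) : ℂ)‖ := by
  refine norm_integral_le_of_norm_le (hρ.integrable_pow_mul_profile le_rfl).ofReal.norm
    (Eventually.of_forall fun r => ?_)
  rw [norm_mul, mul_comm Complex.I, Complex.norm_exp_ofReal_mul_I, one_mul]

/-- Insert `1/(λ - irq) = ∫₀^∞ e^{-(λ - irq)t} dt` and exchange the integrals; `Re λ > 0` gives
absolute convergence. -/
theorem IsChargeDistribution.integral_div_eq_laplace {lam : ℂ} (hlam : 0 < lam.re) (q : ℝ) :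
    ∫ r : ℝ, ((r ^ 3 * profile ρ r : ℝ) : ℂ) / (lam - Complex.I * (r * q : ℝ)) =
      ∫ t in Ioi (0 : ℝ), Complex.exp (-(lam * t)) * waveKernel ρ (q * t) := by
  have hre : ∀ r : ℝ, (-(lam - Complex.I * (r * q : ℝ))).re < 0 := fun r => by
    simpa using hlam
  have e1 : ∀ t : ℝ, Complex.exp (-(lam * t)) * waveKernel ρ (q * t) =
      ∫ r : ℝ, Complex.exp (-(lam - Complex.I * (r * q : ℝ)) * t) *
        ((r ^ 3 * profile ρ r : ℝ) : ℂ) := fun t => by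
    rw [waveKernel, ← integral_const_mul]
    refine integral_congr_ae (Eventually.of_forall fun r => ?_)
    simp only
    rw [← mul_assoc, ← Complex.exp_add]
    congr 2
    push_cast
    ring
  simp only [e1]
  rw [integral_integral_swap]
  · refine integral_congr_ae (Eventually.of_forall fun r => ?_)
    simp only
    rw [integral_mul_const, integral_exp_mul_complex_Ioi (hre r)]
    rw [Complex.ofReal_zero, mul_zero, Complex.exp_zero, neg_div_neg_eq, div_mul_eq_mul_div,
      one_mul]
  · have i1 : Integrable (fun z : ℝ × ℝ => ((Real.exp (-lam.re * z.1) : ℝ) : ℂ) *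
        ((z.2 ^ 3 * profile ρ z.2 : ℝ) : ℂ)) ((volume.restrict (Ioi 0)).prod volume) :=
      Integrable.mul_prod (L := ℂ)
        (f := fun t : ℝ => ((Real.exp (-lam.re * t) : ℝ) : ℂ))
        (g := fun r : ℝ => ((r ^ 3 * profile ρ r : ℝ) : ℂ))
        (integrableOn_exp_mul_Ioi (by linarith) 0).ofReal
        (hρ.integrable_pow_mul_profile le_rfl).ofReal
    have hp := hρ.continuous_profile
    refine i1.mono (Continuous.aestronglyMeasurable (by fun_prop)) (Eventually.of_forall fun z => ?_)
    simp only [Function.uncurry, norm_mul]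
    refine mul_le_mul_of_nonneg_right (le_of_eq ?_) (norm_nonneg _)
    rw [Complex.norm_exp, Complex.norm_real, Real.norm_of_nonneg (Real.exp_pos _).le]
    simp

/-- The integrand satisfies `conj f(t) = f(-t)`, so twice the real part of the half-line integral is
the full-line integral, which Fourier inversion evaluates. -/
theorem IsChargeDistribution.re_integral_exp_mul_waveKernel (om : ℝ) {q : ℝ} (hq : 0 < q) :
    (∫ t in Ioi (0 : ℝ), Complex.exp (-(Complex.I * om * t)) * waveKernel ρ (q * t)).re =
      Real.pi / q * ((om / q) ^ 3 * profile ρ (om / q)) := by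
  set f : ℝ → ℂ := fun t => Complex.exp (-(Complex.I * om * t)) * waveKernel ρ (q * t) with hf
  have hk := hρ.continuous_waveKernel
  have hint : Integrable f := by
    refine (hρ.integrable_waveKernel.comp_mul_left' hq.ne').bdd_mul (c := 1) (by fun_prop)
      (Eventually.of_forall fun t => ?_)
    rw [Complex.norm_exp]
    simp
  have hconj : ∀ t, (starRingEnd ℂ) (f t) = f (-t) := fun t => by
    simp only [hf, map_mul, ← Complex.exp_conj, conj_waveKernel]
    simp
  have h1 : ∫ t, f t = (starRingEnd ℂ) (∫ t in Ioi (0 : ℝ), f t) + ∫ t in Ioi (0 : ℝ), f t := by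
    rw [← integral_conj, integral_eq_integral_Ioi_add_integral_neg_Ioi hint]
    simp only [hconj]
  have h2 : ∫ t, f t = (q⁻¹ : ℝ) • (2 * Real.pi *
      (((om / q) ^ 3 * profile ρ (om / q) : ℝ) : ℂ)) := by
    rw [← hρ.integral_exp_mul_waveKernel, ← abs_of_pos (inv_pos.mpr hq),
      ← Measure.integral_comp_mul_left]
    refine integral_congr_ae (Eventually.of_forall fun t => ?_)
    simp only [hf]
    congr 3
    have : (q : ℂ) ≠ 0 := by exact_mod_cast hq.ne'
    push_cast
    field_simp
  have h3 := congrArg Complex.re (h1.symm.trans h2)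
  rw [Complex.add_re, Complex.conj_re] at h3
  have h4 : ((q⁻¹ : ℝ) • (2 * Real.pi *
      (((om / q) ^ 3 * profile ρ (om / q) : ℝ) : ℂ))).re =
      q⁻¹ * (2 * Real.pi * ((om / q) ^ 3 * profile ρ (om / q))) := by
    rw [Complex.real_smul, ← Complex.ofReal_ofNat, ← Complex.ofReal_mul, ← Complex.ofReal_mul,
      ← Complex.ofReal_mul, Complex.ofReal_re]
  rw [h4] at h3
  rw [div_eq_mul_inv]
  linarith

end Laplace

/-! ### The entire extension of `H_jj` and its values on the imaginary axis. -/

/-- The entire function extending the diagonal entry `H_{jj}`, when `T` is large enough. -/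
def HExt (ρ : E3 → ℝ) (v : E3) (T : ℝ) (j : Fin 3) (lam : ℂ) : ℂ :=
  ∫ z : Metric.sphere (0 : E3) 1 × ℝ,
    (((z.1 : E3) j ^ 2 : ℝ) : ℂ) / (2 * Complex.I) *
      waveKernel ρ ((1 - inner ℝ v (z.1 : E3)) * z.2) * Complex.exp (-(lam * z.2))
    ∂((volume : Measure E3).toSphere.prod (volume.restrict (Ioc 0 T)))

theorem one_sub_norm_le_one_sub_inner (v : E3) (θ : Metric.sphere (0 : E3) 1) :
    1 - ‖v‖ ≤ 1 - inner ℝ v (θ : E3) := by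
  have h1 := real_inner_le_norm v (θ : E3)
  have h2 : ‖(θ : E3)‖ = 1 := by simp
  rw [h2, mul_one] at h1
  linarith

theorem Dhat_eq_mul (v : E3) (lam : ℂ) (k : E3) :
    Dhat v lam k = (lam - Complex.I * (‖k‖ - inner ℝ v k : ℝ)) *
      (lam + Complex.I * (‖k‖ + inner ℝ v k : ℝ)) := by
  rw [Dhat]
  push_cast
  linear_combination ((‖k‖ : ℂ) ^ 2) * Complex.I_sq

section Extension

variable {ρ : E3 → ℝ} (hρ : IsChargeDistribution ρ)
include hρ

theorem IsChargeDistribution.integrable_HExt_coeff (v : E3) (T : ℝ) (j : Fin 3) :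
    Integrable (fun z : Metric.sphere (0 : E3) 1 × ℝ => (((z.1 : E3) j ^ 2 : ℝ) : ℂ) /
      (2 * Complex.I) * waveKernel ρ ((1 - inner ℝ v (z.1 : E3)) * z.2))
      ((volume : Measure E3).toSphere.prod (volume.restrict (Ioc 0 T))) := by
  have hk := hρ.continuous_waveKernel
  refine Integrable.of_bound (C := 1 * ∫ r : ℝ, ‖((r ^ 3 * profile ρ r : ℝ) : ℂ)‖)
    (Continuous.aestronglyMeasurable (by fun_prop)) (Eventually.of_forall fun z => ?_)
  rw [norm_mul]
  refine mul_le_mul ?_ (hρ.norm_waveKernel_le _) (norm_nonneg _) zero_le_one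
  have h1 : |(z.1 : E3) j| ≤ 1 := by
    have := PiLp.norm_apply_le (z.1 : E3) j
    rwa [Real.norm_eq_abs, norm_eq_of_mem_sphere] at this
  rw [norm_div, Complex.norm_real, norm_mul, Complex.norm_I, Complex.norm_ofNat, norm_pow,
    Real.norm_eq_abs]
  have h2 : |(z.1 : E3) j| ^ 2 ≤ 1 := pow_le_one₀ (abs_nonneg _) h1
  linarith

theorem IsChargeDistribution.differentiable_HExt (v : E3) (T : ℝ) (j : Fin 3) :
    Differentiable ℂ (HExt ρ v T j) := by
  refine differentiable_integral_mul_exp (T := |T|) (hρ.integrable_HExt_coeff v T j)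
    (b := fun z : Metric.sphere (0 : E3) 1 × ℝ => z.2) measurable_snd ?_
  have h : ∀ᵐ t ∂(volume.restrict (Ioc 0 T)), t ∈ Ioc 0 T := ae_restrict_mem measurableSet_Ioc
  have h' := Measure.quasiMeasurePreserving_snd (μ := (volume : Measure E3).toSphere)
    (ν := volume.restrict (Ioc 0 T)) |>.ae h
  filter_upwards [h'] with z hz
  rw [abs_of_pos hz.1]
  exact hz.2.trans (le_abs_self T)

theorem IsChargeDistribution.integrable_HExt_integrand (v : E3) (T : ℝ) (j : Fin 3) (lam : ℂ) :
    Integrable (fun z : Metric.sphere (0 : E3) 1 × ℝ => (((z.1 : E3) j ^ 2 : ℝ) : ℂ) /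
      (2 * Complex.I) * waveKernel ρ ((1 - inner ℝ v (z.1 : E3)) * z.2) *
        Complex.exp (-(lam * z.2)))
      ((volume : Measure E3).toSphere.prod (volume.restrict (Ioc 0 T))) := by
  refine (hρ.integrable_HExt_coeff v T j).mul_bdd (c := Real.exp (‖lam‖ * |T|))
    (Continuous.aestronglyMeasurable (by fun_prop)) ?_
  have h : ∀ᵐ t ∂(volume.restrict (Ioc 0 T)), t ∈ Ioc 0 T := ae_restrict_mem measurableSet_Ioc
  have h' := Measure.quasiMeasurePreserving_snd (μ := (volume : Measure E3).toSphere)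
    (ν := volume.restrict (Ioc 0 T)) |>.ae h
  filter_upwards [h'] with z hz
  rw [Complex.norm_exp]
  gcongr
  refine (Complex.re_le_norm _).trans ?_
  rw [norm_neg, norm_mul, Complex.norm_real, Real.norm_eq_abs, abs_of_pos hz.1]
  gcongr
  exact hz.2.trans (le_abs_self T)

omit hρ in
-- Cutting time off at `T` loses nothing: since `1 - v·θ ≥ 1 - |v|` in every direction, the kernel
-- has already vanished for `t > T`.
theorem setIntegral_HExt_integrand {v : E3} {T : ℝ}
    (hT : ∀ t, (1 - ‖v‖) * T < |t| → waveKernel ρ t = 0) (hv : ‖v‖ < 1) (c lam : ℂ)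
    (θ : Metric.sphere (0 : E3) 1) :
    ∫ t in Ioc 0 T, c * waveKernel ρ ((1 - inner ℝ v (θ : E3)) * t) * Complex.exp (-(lam * t)) =
      c * ∫ t in Ioi (0 : ℝ), Complex.exp (-(lam * t)) *
        waveKernel ρ ((1 - inner ℝ v (θ : E3)) * t) := by
  rw [← integral_const_mul]
  have hq := one_sub_norm_le_one_sub_inner v θ
  refine (setIntegral_congr_fun measurableSet_Ioc fun t _ => by ring).trans
    (setIntegral_eq_of_subset_of_forall_sdiff_eq_zero measurableSet_Ioi Ioc_subset_Ioi_self
      ?_).symm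
  intro t ht
  have ht0 : 0 < t := ht.1
  have htT : T < t := not_le.mp fun h => ht.2 ⟨ht0, h⟩
  rw [hT, mul_zero, mul_zero]
  rw [abs_of_pos (mul_pos (by linarith) ht0)]
  calc (1 - ‖v‖) * T < (1 - ‖v‖) * t := mul_lt_mul_of_pos_left htT (by linarith)
    _ ≤ _ := mul_le_mul_of_nonneg_right hq ht0.le

/-- `HExt` as an iterated integral over the half-line, the kernel having compact support. -/
theorem IsChargeDistribution.HExt_eq_integral {v : E3} {T : ℝ}
    (hT : ∀ t, (1 - ‖v‖) * T < |t| → waveKernel ρ t = 0) (hv : ‖v‖ < 1) (j : Fin 3) (lam : ℂ) :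
    HExt ρ v T j lam = ∫ θ : Metric.sphere (0 : E3) 1, (((θ : E3) j ^ 2 : ℝ) : ℂ) /
      (2 * Complex.I) * (∫ t in Ioi (0 : ℝ), Complex.exp (-(lam * t)) *
        waveKernel ρ ((1 - inner ℝ v (θ : E3)) * t)) ∂(volume : Measure E3).toSphere := by
  rw [HExt, integral_prod _ (hρ.integrable_HExt_integrand v T j lam)]
  exact integral_congr_ae (Eventually.of_forall fun θ =>
    setIntegral_HExt_integrand hT hv ((((θ : E3) j ^ 2 : ℝ) : ℂ) / (2 * Complex.I)) lam θ)

theorem IsChargeDistribution.integrable_norm_mul : Integrable fun k : E3 =>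
    ‖k‖ * ‖rhoHat ρ k‖ ^ 2 := by
  have h := continuous_rhoHat hρ.integrable
  refine ((integrable_norm_sq_rhoHat hρ.integrable hρ.memLp).add
    hρ.integrable_norm_sq_mul).mono' (by fun_prop) (Eventually.of_forall fun k => ?_)
  rw [Real.norm_of_nonneg (by positivity), Pi.add_apply, ← one_add_mul]
  gcongr
  nlinarith [sq_nonneg (‖k‖ - 1)]

theorem IsChargeDistribution.integrable_coeff_div (j : Fin 3) {d : E3 → ℂ} (hd : Continuous d)
    {ε : ℝ} (hε : 0 < ε) (hdε : ∀ k, ε ≤ ‖d k‖) :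
    Integrable fun k : E3 => ((k j ^ 2 * ‖rhoHat ρ k‖ ^ 2 : ℝ) : ℂ) / (2 * Complex.I * ‖k‖) /
      d k := by
  have h := continuous_rhoHat hρ.integrable
  have hm : Measurable fun k : E3 => ((k j ^ 2 * ‖rhoHat ρ k‖ ^ 2 : ℝ) : ℂ) /
      (2 * Complex.I * ‖k‖) / d k :=
    ((Continuous.measurable (by fun_prop)).div (Continuous.measurable (by fun_prop))).div
      hd.measurable
  refine (hρ.integrable_norm_mul.mul_const ε⁻¹).mono' hm.aestronglyMeasurable
    (Eventually.of_forall fun k => ?_)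
  rw [norm_div, div_eq_mul_inv]
  have h1 : ‖d k‖⁻¹ ≤ ε⁻¹ := by
    have := hdε k
    gcongr
  refine mul_le_mul ?_ h1 (by positivity) (by positivity)
  rw [norm_div, Complex.norm_real, Real.norm_of_nonneg (by positivity), norm_mul, norm_mul,
    Complex.norm_I, Complex.norm_ofNat, Complex.norm_real, norm_norm]
  have h2 : k j ^ 2 ≤ ‖k‖ ^ 2 := by
    rw [← sq_abs]
    exact pow_le_pow_left₀ (abs_nonneg _) (PiLp.norm_apply_le k j) 2
  refine div_le_of_le_mul₀ (by positivity) (by positivity) ?_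
  have h3 : 0 ≤ ‖rhoHat ρ k‖ ^ 2 := by positivity
  nlinarith [mul_le_mul_of_nonneg_right h2 h3, mul_nonneg (sq_nonneg ‖k‖) h3]

theorem IsChargeDistribution.rhoHat_neg (k : E3) : rhoHat ρ (-k) = rhoHat ρ k :=
  rhoHat_eq_of_norm_eq hρ.radial (norm_neg k)

/-- The diagonal entries of `H` extend to entire functions. -/
theorem IsChargeDistribution.H_eq_HExt {v : E3} {T : ℝ}
    (hT : ∀ t, (1 - ‖v‖) * T < |t| → waveKernel ρ t = 0) (hv : ‖v‖ < 1) (j : Fin 3) {lam : ℂ}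
    (hlam : 0 < lam.re) : H ρ v lam j j = HExt ρ v T j lam := by
  set w : E3 → ℂ := fun k => ((k j ^ 2 * ‖rhoHat ρ k‖ ^ 2 : ℝ) : ℂ) / (2 * Complex.I * ‖k‖)
    with hw
  have hnorm : ∀ {z : ℂ}, z.re = lam.re → lam.re ≤ ‖z‖ := fun h => h ▸ Complex.re_le_norm _
  have hne : ∀ {z : ℂ}, z.re = lam.re → z ≠ 0 := fun h hz => by
    rw [hz, Complex.zero_re] at h
    linarith
  have i1 : Integrable fun k => w k / (lam - Complex.I * (‖k‖ - inner ℝ v k : ℝ)) :=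
    hρ.integrable_coeff_div j (by fun_prop) hlam fun k => hnorm (by simp)
  have i2 : Integrable fun k => w k / (lam + Complex.I * (‖k‖ + inner ℝ v k : ℝ)) :=
    hρ.integrable_coeff_div j (by fun_prop) hlam fun k => hnorm (by simp)
  have i3 : Integrable fun k => w k / (lam + Complex.I * (‖k‖ - inner ℝ v k : ℝ)) :=
    hρ.integrable_coeff_div j (by fun_prop) hlam fun k => hnorm (by simp)
  -- Partial fractions: the difference of the two simple fractions is `2i|k|/D̂`, which explains the
  -- weight `1/(2i|k|)` in `w`.
  have e1 : H ρ v lam j j = ∫ k, (w k / (lam - Complex.I * (‖k‖ - inner ℝ v k : ℝ)) -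
      w k / (lam + Complex.I * (‖k‖ + inner ℝ v k : ℝ))) := by
    rw [H, Matrix.of_apply]
    refine integral_congr_ae (Eventually.of_forall fun k => ?_)
    have n1 : lam - Complex.I * (‖k‖ - inner ℝ v k : ℝ) ≠ 0 := hne (by simp)
    have n2 : lam + Complex.I * (‖k‖ + inner ℝ v k : ℝ) ≠ 0 := hne (by simp)
    simp only [Dhat_eq_mul, hw]
    by_cases hk : k = 0
    · simp [hk]
    have n3 : (‖k‖ : ℂ) ≠ 0 := by simpa using hk
    rw [← sq]
    field_simp
    push_cast
    ring
  -- The substitution `k ↦ -k` gives both fractions the same phase `|k| - v·k`, which becomes `rq`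
  -- in polar coordinates.
  have e2 : ∫ k, w k / (lam + Complex.I * (‖k‖ + inner ℝ v k : ℝ)) =
      ∫ k, w k / (lam + Complex.I * (‖k‖ - inner ℝ v k : ℝ)) := by
    rw [← integral_neg_eq_self]
    refine integral_congr_ae (Eventually.of_forall fun k => ?_)
    simp only [hw, norm_neg, inner_neg_right, hρ.rhoHat_neg, PiLp.neg_apply, neg_sq,
      sub_eq_add_neg]
  have i4 : Integrable fun k => w k / (lam - Complex.I * (‖k‖ - inner ℝ v k : ℝ)) -
      w k / (lam + Complex.I * (‖k‖ - inner ℝ v k : ℝ)) := i1.sub i3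
  rw [e1, integral_sub i1 i2, e2, ← integral_sub i1 i3, integral_eq_integral_sphere i4,
    hρ.HExt_eq_integral hT hv]
  refine integral_congr_ae (Eventually.of_forall fun θ => ?_)
  simp only
  set q : ℝ := 1 - inner ℝ v (θ : E3) with hq
  rw [← hρ.integral_div_eq_laplace hlam]
  have hp := hρ.continuous_profile
  set f : ℝ → ℂ := fun r => ((r ^ 3 * profile ρ r : ℝ) : ℂ) / (lam - Complex.I * (r * q : ℝ))
    with hf
  have hfi : Integrable f := by
    refine ((hρ.integrable_pow_mul_profile le_rfl).mul_const lam.re⁻¹).norm.mono'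
      (Continuous.aestronglyMeasurable ?_) (Eventually.of_forall fun r => ?_)
    · exact Continuous.div (by fun_prop) (by fun_prop) fun r => hne (by simp)
    · have h1 : lam.re ≤ ‖lam - Complex.I * (r * q : ℝ)‖ := hnorm (by simp)
      rw [hf, norm_div, Complex.norm_real, norm_mul _ lam.re⁻¹, div_eq_mul_inv,
        Real.norm_of_nonneg (inv_pos.mpr hlam).le]
      gcongr
  -- Since `r³` times the even profile is odd, the negative half-line supplies exactly the second
  -- fraction.
  rw [integral_eq_integral_Ioi_add_integral_neg_Ioi hfi,
    ← integral_add hfi.comp_neg.integrableOn hfi.integrableOn, ← integral_const_mul]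
  refine setIntegral_congr_fun measurableSet_Ioi fun r hr => ?_
  have hr0 : (0 : ℝ) < r := hr
  have hnr : ‖r • (θ : E3)‖ = r := by simp [norm_smul, abs_of_pos hr0]
  have hsub : r - inner ℝ v (r • (θ : E3)) = r * q := by rw [inner_smul_right, hq]; ring
  have n1 : lam - Complex.I * (r * q : ℝ) ≠ 0 := hne (by simp)
  have n2 : lam + Complex.I * (r * q : ℝ) ≠ 0 := hne (by simp)
  have n3 : (r : ℂ) ≠ 0 := by exact_mod_cast hr0.ne'
  have hneg : lam - Complex.I * (-r * q : ℝ) = lam + Complex.I * (r * q : ℝ) := by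
    push_cast
    ring
  simp only [hw, hf, hnr, hsub, hρ.profile_neg, hneg, ← hρ.profile_norm,
    PiLp.smul_apply, smul_eq_mul, Complex.real_smul]
  push_cast at n1 n2 ⊢
  field_simp
  ring

theorem IsChargeDistribution.im_HExt_ne_zero (hW : WienerCondition ρ) {v : E3} {T : ℝ}
    (hT : ∀ t, (1 - ‖v‖) * T < |t| → waveKernel ρ t = 0) (hv : ‖v‖ < 1) (j : Fin 3) {om : ℝ}
    (hom : om ≠ 0) : (HExt ρ v T j (Complex.I * om)).im ≠ 0 := by
  have hqpos : ∀ θ : Metric.sphere (0 : E3) 1, 0 < 1 - inner ℝ v (θ : E3) := fun θ => by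
    have := one_sub_norm_le_one_sub_inner v θ
    linarith
  set g : Metric.sphere (0 : E3) 1 → ℝ := fun θ => (θ : E3) j ^ 2 *
    ((1 - inner ℝ v (θ : E3))⁻¹ ^ 4 * profile ρ (om / (1 - inner ℝ v (θ : E3)))) with hg
  have hp := hρ.continuous_profile
  have hgc : Continuous g := by
    have h1 : Continuous fun θ : Metric.sphere (0 : E3) 1 => om / (1 - inner ℝ v (θ : E3)) :=
      Continuous.div (by fun_prop) (by fun_prop) fun θ => (hqpos θ).ne'
    have h2 : Continuous fun θ : Metric.sphere (0 : E3) 1 => (1 - inner ℝ v (θ : E3))⁻¹ :=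
      Continuous.inv₀ (by fun_prop) fun θ => (hqpos θ).ne'
    fun_prop
  have hpos : 0 < ∫ θ, g θ ∂(volume : Measure E3).toSphere := by
    have hmem : (EuclideanSpace.single j 1 : E3) ∈ Metric.sphere (0 : E3) 1 := by simp
    -- A continuous nonnegative function on the sphere; it is positive at `θ = e_j`, where `θ_j = 1`
    -- and the Wiener condition applies.
    refine hgc.integral_pos_of_hasCompactSupport_nonneg_nonzero
      (HasCompactSupport.of_compactSpace _) (fun θ => ?_)
      (x := ⟨EuclideanSpace.single j 1, hmem⟩) ?_
    · exact mul_nonneg (sq_nonneg _) (mul_nonneg (by positivity) (profile_nonneg _ _))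
    · have h1 := hqpos ⟨EuclideanSpace.single j 1, hmem⟩
      have h2 := profile_pos hW (div_ne_zero hom h1.ne')
      simp only [hg]
      have h3 : (EuclideanSpace.single j (1 : ℝ) : E3) j = 1 := by simp
      rw [h3]
      positivity
  have hint : Integrable (fun θ : Metric.sphere (0 : E3) 1 => (((θ : E3) j ^ 2 : ℝ) : ℂ) /
      (2 * Complex.I) * (∫ t in Ioi (0 : ℝ), Complex.exp (-(Complex.I * om * t)) *
        waveKernel ρ ((1 - inner ℝ v (θ : E3)) * t))) (volume : Measure E3).toSphere := by
    exact (hρ.integrable_HExt_integrand v T j (Complex.I * om)).integral_prod_left.congr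
      (Eventually.of_forall fun θ => setIntegral_HExt_integrand hT hv
        ((((θ : E3) j ^ 2 : ℝ) : ℂ) / (2 * Complex.I)) _ θ)
  have key : (HExt ρ v T j (Complex.I * om)).im =
      -(Real.pi / 2 * om ^ 3) * ∫ θ, g θ ∂(volume : Measure E3).toSphere := by
    rw [hρ.HExt_eq_integral hT hv, ← integral_const_mul]
    have := integral_im hint
    simp only [RCLike.im_eq_complex_im] at this
    rw [← this]
    refine integral_congr_ae (Eventually.of_forall fun θ => ?_)
    have h1 := hρ.re_integral_exp_mul_waveKernel om (hqpos θ)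
    simp only [hg]
    set X := ∫ t in Ioi (0 : ℝ), Complex.exp (-(Complex.I * om * t)) *
        waveKernel ρ ((1 - inner ℝ v (θ : E3)) * t) with hX
    -- As `1/(2i) = -i/2`, the imaginary part of the entry sees only the real part of the Laplace
    -- integral.
    have h2 : (((θ : E3) j ^ 2 : ℝ) : ℂ) / (2 * Complex.I) * X =
        (((θ : E3) j ^ 2 / 2 : ℝ) : ℂ) * (-Complex.I * X) := by
      have := Complex.I_ne_zero
      field_simp
      push_cast
      rw [Complex.I_sq]
      ring
    rw [h2, Complex.im_ofReal_mul]
    have h3 : (-Complex.I * X).im = -X.re := by simp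
    rw [h3, h1]
    have := (hqpos θ).ne'
    field_simp
  rw [key]
  exact mul_ne_zero (neg_ne_zero.mpr (by positivity)) hpos.ne'

end Extension

/-! ### Second-order vanishing of `F` at the origin. -/

theorem Dhat_ofReal (v : E3) (ε : ℝ) (k : E3) :
    Dhat v ε k = ⟨‖k‖ ^ 2 - inner ℝ v k ^ 2 + ε ^ 2, 2 * ε * inner ℝ v k⟩ := by
  apply Complex.ext <;> simp [Dhat, sq] <;> ring

theorem mul_norm_sq_le {v : E3} (k : E3) :
    (1 - ‖v‖ ^ 2) * ‖k‖ ^ 2 ≤ ‖k‖ ^ 2 - inner ℝ v k ^ 2 := by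
  have h1 := abs_real_inner_le_norm v k
  have h2 : inner ℝ v k ^ 2 ≤ (‖v‖ * ‖k‖) ^ 2 := by
    rw [← sq_abs]
    exact pow_le_pow_left₀ (abs_nonneg _) h1 2
  nlinarith

theorem inner_sq_le_norm_sq {v : E3} (hv : ‖v‖ < 1) (k : E3) : inner ℝ v k ^ 2 ≤ ‖k‖ ^ 2 := by
  have h1 := mul_norm_sq_le (v := v) k
  have h2 : ‖v‖ ^ 2 < 1 := pow_lt_one₀ (norm_nonneg _) hv two_ne_zero
  nlinarith [mul_nonneg (sub_nonneg.mpr h2.le) (sq_nonneg ‖k‖)]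

theorem coord_sq_le_norm_sq (k : E3) (j : Fin 3) : k j ^ 2 ≤ ‖k‖ ^ 2 := by
  rw [← sq_abs]
  exact pow_le_pow_left₀ (abs_nonneg _) (PiLp.norm_apply_le k j) 2

/-- Pointwise bounds for the symmetrized difference of resolvents. -/
theorem resolvent_diff_bounds {A e s n c : ℝ} (hc : 0 < c) (hn : 0 < n) (hA : c * n ≤ A)
    (hs : s ^ 2 ≤ n) (he : 0 ≤ e) :
    0 ≤ 1 / A - (A + e) / ((A + e) ^ 2 + 4 * e * s ^ 2) ∧
      n * (1 / A - (A + e) / ((A + e) ^ 2 + 4 * e * s ^ 2)) ≤ e * ((1 / c ^ 2 + 4 / c ^ 3) / n) := by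
  have hA0 : 0 < A := lt_of_lt_of_le (by positivity) hA
  -- Here `A = k² - (v·k)²`, `e = ε²`, `s = v·k`, `n = k²` in the application. Over a common
  -- denominator a factor `e` comes out, and positivity is visible.
  have hy : 1 / A - (A + e) / ((A + e) ^ 2 + 4 * e * s ^ 2) =
      e * ((A + e) + 4 * s ^ 2) / (A * ((A + e) ^ 2 + 4 * e * s ^ 2)) := by
    field_simp
    ring
  rw [hy]
  refine ⟨by positivity, ?_⟩
  have h1 : e * ((A + e) + 4 * s ^ 2) / (A * ((A + e) ^ 2 + 4 * e * s ^ 2)) ≤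
      e * (1 / A ^ 2 + 4 * n / A ^ 3) := by
    calc _ ≤ e * ((A + e) + 4 * s ^ 2) / (A * (A + e) ^ 2) := by
          gcongr
          nlinarith [mul_nonneg he (sq_nonneg s)]
      _ = e * (1 / (A * (A + e)) + 4 * s ^ 2 / (A * (A + e) ^ 2)) := by
          field_simp
      _ ≤ e * (1 / (A * A) + 4 * n / (A * A ^ 2)) := by
          gcongr <;> linarith
      _ = _ := by rw [← sq, ← pow_succ']
  have h2 : e * (1 / A ^ 2 + 4 * n / A ^ 3) ≤ e * (1 / (c * n) ^ 2 + 4 * n / (c * n) ^ 3) := by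
    gcongr
  calc _ ≤ n * (e * (1 / (c * n) ^ 2 + 4 * n / (c * n) ^ 3)) := by
        gcongr
        exact h1.trans h2
    _ = _ := by
        field_simp

section NearZero

variable {ρ : E3 → ℝ} (hρ : IsChargeDistribution ρ)
include hρ

/-- The linear bound on `ρ̂` at the origin bounds the quotient on the unit ball; outside it the
quotient is at most `|ρ̂|²`. It is the majorant for the `O(ε²)` estimate of `F`. -/
theorem IsChargeDistribution.integrable_norm_sq_div (h0 : rhoHat ρ 0 = 0) :
    Integrable fun k : E3 => ‖rhoHat ρ k‖ ^ 2 / ‖k‖ ^ 2 := by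
  obtain ⟨R, hR⟩ := hρ.compact
  obtain ⟨C, hC, hbound⟩ := norm_rhoHat_le hρ.integrable hR h0
  have hcont := continuous_rhoHat hρ.integrable
  have h1 : Integrable ((Metric.ball (0 : E3) 1).indicator fun _ => C ^ 2) :=
    (integrable_indicator_iff measurableSet_ball).mpr
      (integrableOn_const (by simp))
  refine (h1.add (integrable_norm_sq_rhoHat hρ.integrable hρ.memLp)).mono'
    ((Continuous.measurable (by fun_prop)).div
      (Continuous.measurable (by fun_prop))).aestronglyMeasurable
    (Eventually.of_forall fun k => ?_)
  rw [Real.norm_of_nonneg (by positivity), Pi.add_apply]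
  by_cases hk : k ∈ Metric.ball (0 : E3) 1
  · rw [indicator_of_mem hk]
    have h2 : ‖rhoHat ρ k‖ ^ 2 / ‖k‖ ^ 2 ≤ C ^ 2 := by
      refine div_le_of_le_mul₀ (by positivity) (by positivity) ?_
      rw [← mul_pow]
      exact pow_le_pow_left₀ (norm_nonneg _) (hbound k) 2
    linarith [sq_nonneg ‖rhoHat ρ k‖]
  · rw [indicator_of_notMem hk, zero_add]
    have h2 : 1 ≤ ‖k‖ := by simpa using hk
    exact div_le_self (by positivity) (one_le_pow₀ h2)

theorem IsChargeDistribution.integrable_K_integrand {v : E3} (hv : ‖v‖ < 1) (j : Fin 3) :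
    Integrable fun k : E3 => k j * k j * ‖rhoHat ρ k‖ ^ 2 / (‖k‖ ^ 2 - inner ℝ v k ^ 2) := by
  have hcont := continuous_rhoHat hρ.integrable
  have hc : 0 < 1 - ‖v‖ ^ 2 := by
    have : ‖v‖ ^ 2 < 1 := pow_lt_one₀ (norm_nonneg _) hv two_ne_zero
    linarith
  refine ((integrable_norm_sq_rhoHat hρ.integrable hρ.memLp).mul_const (1 - ‖v‖ ^ 2)⁻¹).mono'
    ((Continuous.measurable (by fun_prop)).div
      (Continuous.measurable (by fun_prop))).aestronglyMeasurable
    (Eventually.of_forall fun k => ?_)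
  have h1 := mul_norm_sq_le (v := v) k
  have h2 := coord_sq_le_norm_sq k j
  have h3 : 0 ≤ ‖k‖ ^ 2 - inner ℝ v k ^ 2 := le_trans (by positivity) h1
  rw [← sq, Real.norm_of_nonneg (by positivity)]
  refine div_le_of_le_mul₀ h3 (by positivity) ?_
  have h4 : k j ^ 2 ≤ (1 - ‖v‖ ^ 2)⁻¹ * (‖k‖ ^ 2 - inner ℝ v k ^ 2) := by
    rw [inv_mul_eq_div, le_div_iff₀ hc]
    nlinarith
  calc k j ^ 2 * ‖rhoHat ρ k‖ ^ 2 ≤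
        (1 - ‖v‖ ^ 2)⁻¹ * (‖k‖ ^ 2 - inner ℝ v k ^ 2) * ‖rhoHat ρ k‖ ^ 2 := by gcongr
    _ = _ := by ring

theorem IsChargeDistribution.integrable_H_integrand {v : E3} (hv : ‖v‖ < 1) (j : Fin 3) (ε : ℝ) :
    Integrable fun k : E3 => ((k j * k j * ‖rhoHat ρ k‖ ^ 2 : ℝ) : ℂ) / Dhat v ε k := by
  have hcont := continuous_rhoHat hρ.integrable
  have hD : Continuous (Dhat v ε) := by unfold Dhat; fun_prop
  refine (hρ.integrable_K_integrand hv j).mono'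
    ((Continuous.measurable (by fun_prop)).div hD.measurable).aestronglyMeasurable
    (Eventually.of_forall fun k => ?_)
  have h1 := mul_norm_sq_le (v := v) k
  have hc : ‖v‖ ^ 2 < 1 := pow_lt_one₀ (norm_nonneg _) hv two_ne_zero
  rw [norm_div, Complex.norm_real, ← sq, Real.norm_of_nonneg (by positivity)]
  by_cases hk : k = 0
  · simp [hk]
  have h2 : 0 < (1 - ‖v‖ ^ 2) * ‖k‖ ^ 2 :=
    mul_pos (by linarith) (pow_pos (norm_pos_iff.mpr hk) 2)
  have h3 : 0 < ‖k‖ ^ 2 - inner ℝ v k ^ 2 := by linarith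
  gcongr
  refine le_trans ?_ (Complex.re_le_norm _)
  rw [Dhat_ofReal]
  simp only
  nlinarith [sq_nonneg ε]

/-- On the positive half-line `F_{jj}` is real, nonpositive, and of second order at the origin. -/
theorem IsChargeDistribution.F_apply_ofReal_bounds (h0 : rhoHat ρ 0 = 0) {v : E3} (hv : ‖v‖ < 1)
    (j : Fin 3) : ∃ C : ℝ, ∀ ε : ℝ, 0 < ε →
      ∃ x : ℝ, F ρ v ε j j = x ∧ x ≤ 0 ∧ -(C * ε ^ 2) ≤ x := by
  set c : ℝ := 1 - ‖v‖ ^ 2 with hcdef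
  have hc : 0 < c := by
    have : ‖v‖ ^ 2 < 1 := pow_lt_one₀ (norm_nonneg _) hv two_ne_zero
    linarith
  have hq := hρ.integrable_norm_sq_div h0
  refine ⟨∫ k : E3, (1 / c ^ 2 + 4 / c ^ 3) * (‖rhoHat ρ k‖ ^ 2 / ‖k‖ ^ 2), fun ε hε => ?_⟩
  have hiK := hρ.integrable_K_integrand hv j
  have hiH := hρ.integrable_H_integrand hv j ε
  -- For real `ε`, conjugating `D̂` amounts to `k ↦ -k`, so `H_jj(ε)` is real.
  have hconj : (starRingEnd ℂ) (H ρ v ε j j) = H ρ v ε j j := by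
    rw [H, Matrix.of_apply, ← integral_conj]
    conv_rhs => rw [← integral_neg_eq_self]
    refine integral_congr_ae (Eventually.of_forall fun k => ?_)
    simp only [map_div₀, Complex.conj_ofReal, PiLp.neg_apply, hρ.rhoHat_neg, neg_mul_neg]
    congr 1
    rw [Dhat_ofReal, Dhat_ofReal]
    apply Complex.ext <;> simp
  have hre : H ρ v ε j j = ((H ρ v ε j j).re : ℂ) := (Complex.conj_eq_iff_re.mp hconj).symm
  have hx : (H ρ v ε j j).re - (∫ k : E3, k j * k j * ‖rhoHat ρ k‖ ^ 2 /
      (‖k‖ ^ 2 - inner ℝ v k ^ 2)) = -∫ k : E3, k j ^ 2 * ‖rhoHat ρ k‖ ^ 2 *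
        (1 / (‖k‖ ^ 2 - inner ℝ v k ^ 2) - (‖k‖ ^ 2 - inner ℝ v k ^ 2 + ε ^ 2) /
          ((‖k‖ ^ 2 - inner ℝ v k ^ 2 + ε ^ 2) ^ 2 + 4 * ε ^ 2 * inner ℝ v k ^ 2)) := by
    have h1 : (H ρ v ε j j).re = ∫ k : E3,
        (((k j * k j * ‖rhoHat ρ k‖ ^ 2 : ℝ) : ℂ) / Dhat v ε k).re := by
      rw [H, Matrix.of_apply]
      exact (integral_re hiH).symm
    have hiR : Integrable fun k : E3 =>
        (((k j * k j * ‖rhoHat ρ k‖ ^ 2 : ℝ) : ℂ) / Dhat v ε k).re := hiH.re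
    rw [h1, ← integral_sub hiR hiK, ← integral_neg]
    refine integral_congr_ae (Eventually.of_forall fun k => ?_)
    simp only
    rw [div_eq_mul_inv, Complex.re_ofReal_mul, Complex.inv_re, Dhat_ofReal, Complex.normSq_mk]
    simp only
    ring_nf
  refine ⟨(H ρ v ε j j).re - (∫ k : E3, k j * k j * ‖rhoHat ρ k‖ ^ 2 /
      (‖k‖ ^ 2 - inner ℝ v k ^ 2)), ?_, ?_, ?_⟩
  · rw [Complex.ofReal_sub, ← hre, F, Matrix.sub_apply, K, Matrix.of_apply]
  · rw [hx, neg_nonpos]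
    refine integral_nonneg fun k => ?_
    by_cases hk : k = 0
    · simp [hk]
    refine mul_nonneg (by positivity) (resolvent_diff_bounds hc
      (pow_pos (norm_pos_iff.mpr hk) 2) (mul_norm_sq_le k) (inner_sq_le_norm_sq hv k)
      (sq_nonneg ε)).1
  · rw [hx, neg_le_neg_iff, ← integral_mul_const]
    refine integral_mono_of_nonneg (Eventually.of_forall fun k => ?_)
      ((hq.const_mul _).mul_const _) (Eventually.of_forall fun k => ?_)
    · by_cases hk : k = 0
      · simp [hk]
      exact mul_nonneg (by positivity) (resolvent_diff_bounds hc
        (pow_pos (norm_pos_iff.mpr hk) 2) (mul_norm_sq_le k) (inner_sq_le_norm_sq hv k)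
        (sq_nonneg ε)).1
    · by_cases hk : k = 0
      · simp [hk]
      obtain ⟨hb1, hb2⟩ := resolvent_diff_bounds hc
        (pow_pos (norm_pos_iff.mpr hk) 2) (mul_norm_sq_le k) (inner_sq_le_norm_sq hv k)
        (sq_nonneg ε)
      simp only
      set y := 1 / (‖k‖ ^ 2 - inner ℝ v k ^ 2) - (‖k‖ ^ 2 - inner ℝ v k ^ 2 + ε ^ 2) /
          ((‖k‖ ^ 2 - inner ℝ v k ^ 2 + ε ^ 2) ^ 2 + 4 * ε ^ 2 * inner ℝ v k ^ 2)
      calc k j ^ 2 * ‖rhoHat ρ k‖ ^ 2 * y ≤ ‖k‖ ^ 2 * ‖rhoHat ρ k‖ ^ 2 * y := by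
            have := coord_sq_le_norm_sq k j
            gcongr ?_ * _ * _
        _ = ‖rhoHat ρ k‖ ^ 2 * (‖k‖ ^ 2 * y) := by ring
        _ ≤ ‖rhoHat ρ k‖ ^ 2 * (ε ^ 2 * ((1 / c ^ 2 + 4 / c ^ 3) / ‖k‖ ^ 2)) := by gcongr
        _ = _ := by ring

end NearZero

/-- An entire function that is real, nonpositive and `O(ε²)` on the positive half-line factors as
`z² G(z)` with `G` entire and `Re G(0) ≤ 0`. -/
theorem exists_eq_sq_mul {f : ℂ → ℂ} (hf : Differentiable ℂ f) {C : ℝ}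
    (h : ∀ ε : ℝ, 0 < ε → ∃ x : ℝ, f ε = x ∧ x ≤ 0 ∧ -(C * ε ^ 2) ≤ x) :
    ∃ G : ℂ → ℂ, Differentiable ℂ G ∧ (∀ z, f z = z ^ 2 * G z) ∧ (G 0).re ≤ 0 := by
  have hdslope : ∀ {g : ℂ → ℂ}, Differentiable ℂ g → Differentiable ℂ (dslope g 0) := fun hg =>
    differentiableOn_univ.mp ((Complex.differentiableOn_dslope univ_mem).mpr hg.differentiableOn)
  have htend : ∀ {g : ℂ → ℂ}, Differentiable ℂ g →
      Tendsto (fun ε : ℝ => g ε) (𝓝[>] 0) (𝓝 (g 0)) := fun {g} hg => by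
    have h1 : Continuous fun ε : ℝ => g ε := hg.continuous.comp Complex.continuous_ofReal
    simpa using (h1.tendsto 0).mono_left nhdsWithin_le_nhds
  have hnorm : ∀ ε : ℝ, 0 < ε → ‖f ε‖ ≤ C * ε ^ 2 := fun ε hε => by
    obtain ⟨x, hx, hx0, hxC⟩ := h ε hε
    rw [hx, Complex.norm_real, Real.norm_eq_abs, abs_of_nonpos hx0]
    linarith
  have hf0 : f 0 = 0 := by
    refine tendsto_nhds_unique (htend hf) (squeeze_zero_norm' (a := fun ε : ℝ => C * ε ^ 2) ?_ ?_)
    · filter_upwards [self_mem_nhdsWithin] with ε hε using hnorm ε hε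
    · have h1 : Continuous fun ε : ℝ => C * ε ^ 2 := by fun_prop
      simpa using (h1.tendsto 0).mono_left nhdsWithin_le_nhds
  set g := dslope f 0 with hg
  have hfg : ∀ z, f z = z * g z := fun z => by
    simpa [hf0] using (sub_smul_dslope f 0 z).symm
  have hg0 : g 0 = 0 := by
    refine tendsto_nhds_unique (htend (hdslope hf))
      (squeeze_zero_norm' (a := fun ε : ℝ => C * ε) ?_ ?_)
    · filter_upwards [self_mem_nhdsWithin] with ε hε
      have hε0 : (0 : ℝ) < ε := hε
      have h1 := hnorm ε hε
      rw [hfg, norm_mul, Complex.norm_real, Real.norm_of_nonneg hε0.le] at h1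
      refine le_of_mul_le_mul_left ?_ hε0
      linarith
    · have h1 : Continuous fun ε : ℝ => C * ε := by fun_prop
      simpa using (h1.tendsto 0).mono_left nhdsWithin_le_nhds
  have hgG : ∀ z, g z = z * dslope g 0 z := fun z => by
    simpa [hg0] using (sub_smul_dslope g 0 z).symm
  have hfG : ∀ z, f z = z ^ 2 * dslope g 0 z := fun z => by rw [hfg, hgG]; ring
  have hG := hdslope (hdslope hf)
  -- `Re G(0)` is the limit of `f(ε)/ε² ≤ 0` along the positive reals.
  have hre : (dslope g 0 0).re ≤ 0 := by
    refine le_of_tendsto ((Complex.continuous_re.tendsto _).comp (htend hG)) ?_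
    filter_upwards [self_mem_nhdsWithin] with ε hε
    have hε0 : (0 : ℝ) < ε := hε
    obtain ⟨x, hx, hx0, -⟩ := h ε hε
    have h1 : dslope g 0 (ε : ℂ) = ((x / ε ^ 2 : ℝ) : ℂ) := by
      have : (ε : ℂ) ≠ 0 := by exact_mod_cast hε0.ne'
      push_cast
      rw [eq_div_iff (pow_ne_zero 2 this), ← hx, hfG]
      ring
    rw [Function.comp_apply, h1, Complex.ofReal_re]
    exact div_nonpos_of_nonpos_of_nonneg hx0 (sq_nonneg _)
  exact ⟨dslope g 0, hG, hfG, hre⟩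

/-! ### Reflection symmetry and vanishing of the off-diagonal entries. -/

/-- The reflection of `ℝ³` reversing the `m`-th coordinate. -/
def coordFlip (m : Fin 3) : E3 ≃ₗᵢ[ℝ] E3 :=
  LinearIsometryEquiv.piLpCongrRight 2 fun l =>
    if l = m then LinearIsometryEquiv.neg ℝ else LinearIsometryEquiv.refl ℝ ℝ

theorem coordFlip_apply (m : Fin 3) (k : E3) (l : Fin 3) :
    coordFlip m k l = if l = m then -k l else k l := by
  by_cases h : l = m <;> simp [coordFlip, h]

/-- Of two distinct indices at least one is not `0`. Flipping that coordinate changes the sign of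
`kᵢkⱼ`, while `v·k` is unchanged when `v` lies along the first axis. -/
theorem exists_coordFlip_mul {i j : Fin 3} (hij : i ≠ j) :
    ∃ m : Fin 3, m ≠ 0 ∧ ∀ k : E3, coordFlip m k i * coordFlip m k j = -(k i * k j) := by
  by_cases hi : i = 0
  · exact ⟨j, fun h => hij (hi.trans h.symm), fun k => by simp [coordFlip_apply, hij]⟩
  · exact ⟨i, hi, fun k => by simp [coordFlip_apply, hij.symm]⟩

theorem inner_coordFlip {v : E3} (hcoord : v = EuclideanSpace.single 0 ‖v‖) {m : Fin 3}
    (hm : m ≠ 0) (k : E3) : inner ℝ v (coordFlip m k) = inner ℝ v k := by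
  rw [hcoord]
  simp [EuclideanSpace.inner_single_left, coordFlip_apply, hm.symm]

section OffDiagonal

variable {ρ : E3 → ℝ} (hρ : IsChargeDistribution ρ) {v : E3}
  (hcoord : v = EuclideanSpace.single 0 ‖v‖) {i j : Fin 3} (hij : i ≠ j)
include hρ hcoord hij

theorem IsChargeDistribution.H_apply_ne (lam : ℂ) : H ρ v lam i j = 0 := by
  obtain ⟨m, hm, hmul⟩ := exists_coordFlip_mul hij
  have h1 : H ρ v lam i j = -H ρ v lam i j := by
    conv_lhs => rw [H, Matrix.of_apply, ← (coordFlip m).measurePreserving.integral_comp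
      (coordFlip m).toHomeomorph.measurableEmbedding]
    rw [H, Matrix.of_apply, ← integral_neg]
    refine integral_congr_ae (Eventually.of_forall fun k => ?_)
    simp only [hmul, Dhat, inner_coordFlip hcoord hm, LinearIsometryEquiv.norm_map,
      rhoHat_comp_isometry hρ.radial]
    push_cast
    ring
  exact self_eq_neg.mp h1

theorem IsChargeDistribution.K_apply_ne : K ρ v i j = 0 := by
  obtain ⟨m, hm, hmul⟩ := exists_coordFlip_mul hij
  have h1 : K ρ v i j = -K ρ v i j := by
    conv_lhs => rw [K, Matrix.of_apply, ← (coordFlip m).measurePreserving.integral_comp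
      (coordFlip m).toHomeomorph.measurableEmbedding]
    rw [K, Matrix.of_apply, ← Complex.ofReal_neg, ← integral_neg]
    congr 1
    refine integral_congr_ae (Eventually.of_forall fun k => ?_)
    simp only [hmul, inner_coordFlip hcoord hm, LinearIsometryEquiv.norm_map,
      rhoHat_comp_isometry hρ.radial]
    ring
  exact self_eq_neg.mp h1

end OffDiagonal

/-! ### Inversion of block matrices with diagonal blocks. -/

/-- The diagonal entries of `B v`, when `v` is parallel to the first axis. -/
def bDiag (v : E3) (j : Fin 3) : ℝ := nu v * (1 - v j ^ 2)

theorem bDiag_pos {v : E3} (hv : ‖v‖ < 1) (j : Fin 3) : 0 < bDiag v j := by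
  have h1 : ‖v‖ ^ 2 < 1 := pow_lt_one₀ (norm_nonneg _) hv two_ne_zero
  have h2 := coord_sq_le_norm_sq v j
  exact mul_pos (Real.sqrt_pos.mpr (by linarith)) (by linarith)

theorem B_eq_diagonal {v : E3} (hcoord : v = EuclideanSpace.single 0 ‖v‖) :
    B v = Matrix.diagonal fun j => (bDiag v j : ℂ) := by
  ext i j
  by_cases hij : i = j
  · subst hij
    simp [B, bDiag, sq]
  · have h1 : v i * v j = 0 := by
      have h2 : ∀ l : Fin 3, l ≠ 0 → v l = 0 := fun l hl => by rw [hcoord]; simp [hl]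
      by_cases hi : i = 0
      · rw [h2 j fun h => hij (hi.trans h.symm), mul_zero]
      · rw [h2 i hi, zero_mul]
    simp only [B, Matrix.of_apply, hij, if_false, h1, Matrix.diagonal_apply_ne _ hij]
    simp

/-- The inverse of a two-by-two block matrix with diagonal blocks. -/
theorem fromBlocks_diagonal_mul_fromBlocks_diagonal {n : Type*} [Fintype n] [DecidableEq n]
    {R : Type*} [CommRing R] {lam : R} {b f x y z : n → R}
    (h11 : ∀ j, lam * x j - b j * z j = 1) (h12 : ∀ j, lam * y j = b j * x j)
    (h21 : ∀ j, lam * z j = f j * x j) (h22 : ∀ j, lam * x j - f j * y j = 1) :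
    Matrix.fromBlocks (lam • 1) (-Matrix.diagonal b) (-Matrix.diagonal f) (lam • 1) *
      Matrix.fromBlocks (Matrix.diagonal x) (Matrix.diagonal y) (Matrix.diagonal z)
        (Matrix.diagonal x) = 1 := by
  rw [Matrix.fromBlocks_multiply, ← Matrix.fromBlocks_one]
  congr 1 <;> ext i j <;> by_cases hij : i = j
  · subst hij
    simpa [sub_eq_add_neg] using h11 i
  · simp [hij]
  · subst hij
    simpa [← sub_eq_add_neg, sub_eq_zero] using h12 i
  · simp [hij]
  · subst hij
    simpa [neg_add_eq_zero, eq_comm] using h21 i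
  · simp [hij]
  · subst hij
    simpa [neg_add_eq_sub] using h22 i
  · simp [hij]

end WaveParticle

open WaveParticle

theorem lemma9p5 (ρ : WaveParticle.E3 → ℝ)
    (hρ : WaveParticle.IsChargeDistribution ρ)
    (hW : WaveParticle.WienerCondition ρ)
    (h0 : WaveParticle.FifthOrderZero ρ)
    (v : WaveParticle.E3) (hv : ‖v‖ < 1)
    (hcoord : v = EuclideanSpace.single 0 ‖v‖)
    (r : ℝ) (hr : 0 < r) :
    -- the limit defining `M(iom) = M(iom + 0)` exists for every real `om`
    (∀ om : ℝ, Tendsto (fun ε : ℝ => WaveParticle.M ρ v (Complex.I * om + ε)) (𝓝[>] 0)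
      (𝓝 (WaveParticle.MBoundary ρ v om))) ∧
    ∃ L₁₁ L₁₂ L₂₁ L₂₂ : ℝ → Matrix (Fin 3) (Fin 3) ℂ,
      (∀ L ∈ ({L₁₁, L₁₂, L₂₁, L₂₂} : Set (ℝ → Matrix (Fin 3) (Fin 3) ℂ)),
        (∀ i j, ContDiffOn ℝ ∞ (fun om => L om i j) (Ioo (-r - 1) (r + 1))) ∧
        ∀ om ∈ Ioo (-r - 1) (r + 1), (L om).IsDiag) ∧
      (∀ om ∈ Ioo (-r - 1) (r + 1), om ≠ 0 →
        IsUnit (WaveParticle.MBoundary ρ v om) ∧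
        (WaveParticle.MBoundary ρ v om)⁻¹ =
          Matrix.fromBlocks
            ((1 / (om : ℂ)) • L₁₁ om) ((1 / (om : ℂ) ^ 2) • L₁₂ om)
            (L₂₁ om) ((1 / (om : ℂ)) • L₂₂ om)) ∧
      ∀ om ∈ Ioo (-r - 1) (r + 1),
        L₁₁ om = Complex.I • (L₁₂ om * (WaveParticle.B v)⁻¹) := by
  have hzero : rhoHat ρ 0 = 0 := by
    have h1 := congrArg (fun m => m 0) (h0 0 (by norm_num))
    simpa using h1
  obtain ⟨T₀, hT₀, hker⟩ := hρ.exists_waveKernel_eq_zero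
  -- The slowest direction has `q ≥ 1 - |v|`, so this `T` exhausts the kernel in all directions.
  set T : ℝ := T₀ / (1 - ‖v‖) with hTdef
  have hT : ∀ t, (1 - ‖v‖) * T < |t| → waveKernel ρ t = 0 := fun t ht => by
    rw [hTdef, mul_div_cancel₀ _ (by linarith : (1 - ‖v‖) ≠ 0)] at ht
    exact hker t ht
  set f : Fin 3 → ℂ → ℂ := fun j lam => HExt ρ v T j lam - K ρ v j j with hf
  have hfd : ∀ j, Differentiable ℂ (f j) := fun j =>
    (hρ.differentiable_HExt v T j).sub_const _
  have hF : ∀ lam : ℂ, 0 < lam.re → F ρ v lam = Matrix.diagonal fun j => f j lam := by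
    intro lam hlam
    ext i j
    by_cases hij : i = j
    · subst hij
      simp [F, hf, hρ.H_eq_HExt hT hv _ hlam]
    · simp [F, hρ.H_apply_ne hcoord hij, hρ.K_apply_ne hcoord hij, hij]
  have hG : ∀ j, ∃ G : ℂ → ℂ, Differentiable ℂ G ∧ (∀ z, f j z = z ^ 2 * G z) ∧
      (G 0).re ≤ 0 := fun j => by
    obtain ⟨C, hC⟩ := hρ.F_apply_ofReal_bounds hzero hv j
    refine exists_eq_sq_mul (hfd j) (C := C) fun ε hε => ?_
    have h1 := hC ε hε
    rwa [hF ε (by simpa using hε), Matrix.diagonal_apply_eq] at h1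
  choose G hGd hfG hGre using hG
  set b : Fin 3 → ℂ := fun j => (bDiag v j : ℂ) with hb
  have hb0 : ∀ j, b j ≠ 0 := fun j => Complex.ofReal_ne_zero.mpr (bDiag_pos hv j).ne'
  have hB : B v = Matrix.diagonal b := B_eq_diagonal hcoord
  -- The continuous extension of `M` from the right half-plane; its values at `iω` are the boundary
  -- limits.
  set N : ℂ → Matrix (Fin 3 ⊕ Fin 3) (Fin 3 ⊕ Fin 3) ℂ := fun lam =>
    Matrix.fromBlocks (lam • 1) (-Matrix.diagonal b) (-Matrix.diagonal fun j => f j lam)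
      (lam • 1) with hN
  have hNc : Continuous N := by
    have h1 : Continuous fun lam : ℂ => fun j => f j lam :=
      continuous_pi fun j => (hfd j).continuous
    exact Continuous.matrix_fromBlocks (by fun_prop) (by fun_prop)
      (Continuous.matrix_diagonal h1).neg (by fun_prop)
  have hlim : ∀ om : ℝ, Tendsto (fun ε : ℝ => M ρ v (Complex.I * om + ε)) (𝓝[>] 0)
      (𝓝 (N (Complex.I * om))) := fun om => by
    have h1 : Continuous fun ε : ℝ => N (Complex.I * om + ε) := by fun_prop
    have h2 : Tendsto (fun ε : ℝ => N (Complex.I * om + ε)) (𝓝[>] 0)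
        (𝓝 (N (Complex.I * om))) := by
      simpa using (h1.tendsto 0).mono_left nhdsWithin_le_nhds
    refine h2.congr' ?_
    filter_upwards [self_mem_nhdsWithin] with ε hε
    rw [hN, M, hF _ (by simpa using hε), hB]
  have hMB : ∀ om : ℝ, MBoundary ρ v om = N (Complex.I * om) := fun om => (hlim om).limUnder_eq
  -- The `j`-th block determinant is `λ² - b_j f_j(λ) = λ² d_j` at `λ = iω`.
  set d : Fin 3 → ℝ → ℂ := fun j om => 1 - b j * G j (Complex.I * om) with hd
  have hd0 : ∀ j om, d j om ≠ 0 := by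
    intro j om hzero
    have hbp := bDiag_pos hv j
    by_cases hom : om = 0
    · have h1 := congrArg Complex.re hzero
      simp only [hd, hb, hom, Complex.ofReal_zero, mul_zero, Complex.sub_re, Complex.one_re,
        Complex.re_ofReal_mul, Complex.zero_re] at h1
      nlinarith [hGre j]
    -- For `ω ≠ 0` a zero of `d_j` would make `G_j(iω)` real, hence also `f_j(iω) = -ω² G_j(iω)`;
    -- since `K_jj` is real, this contradicts the nonvanishing of `Im H_jj(iω)`.
    · have h1 := congrArg Complex.im hzero
      simp only [hd, hb, Complex.sub_im, Complex.one_im, Complex.im_ofReal_mul,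
        Complex.zero_im, zero_sub, neg_eq_zero, mul_eq_zero, hbp.ne', false_or] at h1
      have h2 := congrArg Complex.im (hfG j (Complex.I * om))
      have h3 : (Complex.I * (om : ℂ)) ^ 2 = ((-om ^ 2 : ℝ) : ℂ) := by
        rw [mul_pow, Complex.I_sq]
        push_cast
        ring
      rw [h3, Complex.im_ofReal_mul, h1, mul_zero] at h2
      refine hρ.im_HExt_ne_zero hW hT hv j hom ?_
      simpa [hf, K] using h2
  have hsmooth : ∀ j, ContDiff ℝ ∞ fun om : ℝ => G j (Complex.I * om) := fun j =>
    ((hGd j).contDiff.restrict_scalars ℝ).comp (contDiff_const.mul Complex.ofRealCLM.contDiff)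
  have hdsmooth : ∀ j, ContDiff ℝ ∞ (d j) := fun j =>
    contDiff_const.sub (contDiff_const.mul (hsmooth j))
  have hdiag : ∀ g : Fin 3 → ℝ → ℂ, (∀ j, ContDiff ℝ ∞ (g j)) →
      (∀ i j, ContDiffOn ℝ ∞ (fun om => Matrix.diagonal (fun l => g l om) i j)
        (Ioo (-r - 1) (r + 1))) ∧
      ∀ om ∈ Ioo (-r - 1) (r + 1), (Matrix.diagonal fun l => g l om).IsDiag := by
    refine fun g hg => ⟨fun i j => ?_, fun om _ => Matrix.isDiag_diagonal _⟩
    by_cases hij : i = j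
    · subst hij
      simpa using (hg i).contDiffOn
    · simpa [hij] using contDiffOn_const
  have hdiv : ∀ j (g : ℝ → ℂ), ContDiff ℝ ∞ g → ContDiff ℝ ∞ fun om => g om / d j om :=
    fun j g hg => by
      simp only [div_eq_mul_inv]
      exact hg.mul ((hdsmooth j).inv (hd0 j))
  -- At `λ = iω` the 2×2 inverse has entries `λ/(λ²d) = (1/ω)(-i/d)`, `b/(λ²d) = (1/ω²)(-b/d)` and
  -- `f/(λ²d) = G/d`.
  refine ⟨fun om => by rw [hMB]; exact hlim om,
    fun om => Matrix.diagonal fun j => -Complex.I / d j om,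
    fun om => Matrix.diagonal fun j => -b j / d j om,
    fun om => Matrix.diagonal fun j => G j (Complex.I * om) / d j om,
    fun om => Matrix.diagonal fun j => -Complex.I / d j om, ?_, ?_, ?_⟩
  · rintro L (rfl | rfl | rfl | rfl)
    · exact hdiag (fun j om => -Complex.I / d j om) fun j => hdiv j _ contDiff_const
    · exact hdiag (fun j om => -b j / d j om) fun j => hdiv j _ contDiff_const
    · exact hdiag (fun j om => G j (Complex.I * om) / d j om) fun j => hdiv j _ (hsmooth j)
    · exact hdiag (fun j om => -Complex.I / d j om) fun j => hdiv j _ contDiff_const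
  · intro om _ hom
    have homC : (om : ℂ) ≠ 0 := Complex.ofReal_ne_zero.mpr hom
    have hmul : MBoundary ρ v om * Matrix.fromBlocks
        ((1 / (om : ℂ)) • Matrix.diagonal fun j => -Complex.I / d j om)
        ((1 / (om : ℂ) ^ 2) • Matrix.diagonal fun j => -b j / d j om)
        (Matrix.diagonal fun j => G j (Complex.I * om) / d j om)
        ((1 / (om : ℂ)) • Matrix.diagonal fun j => -Complex.I / d j om) = 1 := by
      rw [hMB, ← Matrix.diagonal_smul, ← Matrix.diagonal_smul]
      have hI := Complex.I_sq
      have hd1 : ∀ j, d j om = 1 - b j * G j (Complex.I * om) := fun j => rfl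
      refine fromBlocks_diagonal_mul_fromBlocks_diagonal (fun j => ?_) (fun j => ?_) (fun j => ?_)
        (fun j => ?_) <;> have hdj := hd0 j om <;>
        simp only [Pi.smul_apply, smul_eq_mul, hfG, mul_pow, hI]
      · field_simp
        rw [hd1]
        linear_combination -hI
      · field_simp
      · field_simp
      · field_simp
        rw [hd1]
        linear_combination -hI
    exact ⟨(Matrix.isUnit_iff_isUnit_det _).mpr (Matrix.isUnit_det_of_right_inverse hmul),
      Matrix.inv_eq_right_inv hmul⟩
  · intro om _
    have hBinv : (B v)⁻¹ = Matrix.diagonal fun j => (b j)⁻¹ := by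
      refine Matrix.inv_eq_right_inv ?_
      rw [hB, Matrix.diagonal_mul_diagonal, ← Matrix.diagonal_one]
      congr 1
      ext j
      exact mul_inv_cancel₀ (hb0 j)
    simp only [hBinv, Matrix.diagonal_mul_diagonal, ← Matrix.diagonal_smul]
    congr 1
    ext j
    have := hb0 j
    have := hd0 j om
    simp only [Pi.smul_apply, smul_eq_mul]
    field_simp

end
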